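/- For a finite abelian group $G$ (written additively) and $x,y\in[0,\log|G|]$, let $$f_G(x,y)=\min\{H(X+Y)\;:\;X,Y \text{ independent } G\text{-valued random variables with } H(X)=x,\ H(Y)=y\},$$ where $H(X)=-\sum_{g\in G}P(X=g)\log P(X=g)$ is the Shannon entropy (natural logarithm, $0\log 0=0$). Let $n\ge 0$ and let $G=\mathbb{Z}_{2^n}$ be the cyclic group of order $2^n$. Then for all $x,y\in[0,\log|G|]=[0,n\log 2]$ the minimum defining $f_G(x,y)$ exists; for each fixed $y\in[0,n\log 2]$ the function $x\mapsto f_G(x,y)$ is convex on $[0,n\log 2]$; and for each fixed $x\in[0,n\log 2]$ the function $y\mapsto f_G(x,y)$ is convex on $[0,n\log 2]$. The same holds for every abelian group $G$ of order $2^n$. -/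

import Mathlib

/-- Shannon entropy (natural logarithm, `0 log 0 = 0`) of a probability mass function `p`
on a finite set, `H(p) = - ∑ g, p g * log (p g)`. -/
noncomputable def shannonEntropy {G : Type*} [Fintype G] (p : G → ℝ) : ℝ :=
  ∑ g, Real.negMulLog (p g)

/-- Convolution of functions on a finite abelian group. If `p` and `q` are the laws of
independent `G`-valued random variables `X` and `Y`, this is the law of `X + Y`. -/
def lawOfSum {G : Type*} [AddCommGroup G] [Fintype G] (p q : G → ℝ) : G → ℝ :=
  fun g => ∑ a, p a * q (g - a)

/-- The values `H(X + Y)`, where `X` and `Y` range over all pairs of independent `G`-valued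
random variables with `H(X) = x` and `H(Y) = y` (given by their laws `p` and `q`). -/
def sumEntropies (G : Type*) [AddCommGroup G] [Fintype G] (x y : ℝ) : Set ℝ :=
  {h | ∃ p ∈ stdSimplex ℝ G, ∃ q ∈ stdSimplex ℝ G,
    shannonEntropy p = x ∧ shannonEntropy q = y ∧ h = shannonEntropy (lawOfSum p q)}

/-- `f_G(x, y)`, the minimal entropy of `X + Y` over independent `G`-valued `X`, `Y` with
`H(X) = x` and `H(Y) = y`, meant for `x, y ∈ [0, log |G|]`. That the infimum is then an attained
minimum is asserted separately, in `GeneralizedMGL`. -/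
noncomputable def minSumEntropy (G : Type*) [AddCommGroup G] [Fintype G] (x y : ℝ) : ℝ :=
  sInf (sumEntropies G x y)

/-- The generalized Mrs. Gerber's Lemma for `G`: the minimum defining `f_G` is attained on
`[0, log |G|] × [0, log |G|]`, and there `f_G` is convex in each variable separately. -/
def GeneralizedMGL (G : Type*) [AddCommGroup G] [Fintype G] : Prop :=
  (∀ x ∈ Set.Icc 0 (Real.log (Fintype.card G)), ∀ y ∈ Set.Icc 0 (Real.log (Fintype.card G)),
    IsLeast (sumEntropies G x y) (minSumEntropy G x y)) ∧
  (∀ y ∈ Set.Icc 0 (Real.log (Fintype.card G)),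
    ConvexOn ℝ (Set.Icc 0 (Real.log (Fintype.card G))) (fun x => minSumEntropy G x y)) ∧
  (∀ x ∈ Set.Icc 0 (Real.log (Fintype.card G)),
    ConvexOn ℝ (Set.Icc 0 (Real.log (Fintype.card G))) (fun y => minSumEntropy G x y))

/-!
For `x`, `y` in a common interval `[k log 2, (k + 1) log 2]` the minimal entropy of `X + Y` on an
abelian group of order `2 ^ n` is `k log 2 + f (x - k log 2) (y - k log 2)`, where `f` (`gerber`) is
the corresponding function for the group of order two; for all other `x`, `y` it is `max x y`. This
closed form is `iterGerber n`. It depends only on the order of the group, and convexity in each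
variable is read off from it: each piece is convex by Mrs. Gerber's Lemma for bits
(`convexOn_gerber_left`), and the pieces have a common supporting line where they meet
(`convexOn_glue`, `convexOn_iterGerber_left`).

The closed form is attained by laws that are uniform on the cosets of suitable subgroups
(`exists_shannonEntropy_lawOfSum_eq`). That it is a lower bound is proved by induction on `n`
(`iterGerber_le_shannonEntropy_lawOfSum`): for a subgroup `H` of index two, the chain rule and
concavity of entropy bound `H(X + Y)` below by `f` at the entropies `s`, `t` of the cosets of `X`
and `Y`, plus an average of entropies of sums inside `H`, and by the induction hypothesis and
convexity in each variable that average is at least `iterGerber n` at the conditional entropies.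
What remains is the superadditivity
`iterGerber (n + 1) (x + s) (y + t) ≤ iterGerber n x y + f s t` (`iterGerber_add_le`).

This reduces to two properties of `f` on the square `[0, log 2]²`: `f` is subadditive as long as the
sums stay in the square (`gerber_add_le`), and the defect `log 2 - f`, in coordinates centred at
the opposite corner, is superadditive (`gerber_add_sub_le`). Both follow from convexity in each
variable together with star-shapedness along the rays from the respective corner
(`le_add_of_starShaped`). Star-shapedness amounts to Euler-type differential inequalities such as
`x ∂f/∂x + y ∂f/∂y ≤ f` (`euler_le`, `euler_ge`). In terms of the bias `ρ` of a bit, with entropy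
`g ρ`, where biases multiply when independent bits are added, they say that `g ρ / (ρ artanh ρ)` is
superadditive and `(log 2 - g ρ) / (ρ artanh ρ)` is subadditive with respect to multiplication of
the biases.
-/

open Real Set Filter Topology

namespace MrsGerber

universe u

/-! ### The entropy of a bit as a function of its bias -/

/-- Half the log-odds of the law of a bit with bias `ρ`, that is `artanh ρ`. -/
noncomputable def halfLogOdds (ρ : ℝ) : ℝ := (log (1 + ρ) - log (1 - ρ)) / 2

/-- The entropy of a bit of bias `ρ`, i.e. of the law `((1 + ρ) / 2, (1 - ρ) / 2)`. Biases multiply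
when independent bits are added. -/
noncomputable def biasEntropy (ρ : ℝ) : ℝ := binEntropy ((1 - ρ) / 2)

lemma continuous_biasEntropy : Continuous biasEntropy := by
  unfold biasEntropy; fun_prop

@[simp] lemma biasEntropy_zero : biasEntropy 0 = log 2 := by
  simp [biasEntropy]

@[simp] lemma biasEntropy_one : biasEntropy 1 = 0 := by
  simp [biasEntropy]

lemma biasEntropy_neg (ρ : ℝ) : biasEntropy (-ρ) = biasEntropy ρ := by
  unfold biasEntropy
  rw [← binEntropy_one_sub]; congr 1; ring

lemma biasEntropy_abs (ρ : ℝ) : biasEntropy |ρ| = biasEntropy ρ := by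
  rcases abs_choice ρ with h | h <;> rw [h]
  exact biasEntropy_neg ρ

lemma biasEntropy_one_sub_two_mul (m : ℝ) : biasEntropy (1 - 2 * m) = binEntropy m := by
  unfold biasEntropy; congr 1; ring

lemma strictAntiOn_biasEntropy : StrictAntiOn biasEntropy (Icc 0 1) := by
  intro a ha b hb hab
  refine binEntropy_strictMonoOn ⟨?_, ?_⟩ ⟨?_, ?_⟩ ?_ <;> norm_num at * <;> linarith

lemma biasEntropy_le_log_two (ρ : ℝ) : biasEntropy ρ ≤ log 2 := binEntropy_le_log_two

lemma biasEntropy_nonneg {ρ : ℝ} (h0 : 0 ≤ ρ) (h1 : ρ ≤ 1) : 0 ≤ biasEntropy ρ :=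
  binEntropy_nonneg (by linarith) (by linarith)

lemma hasDerivAt_biasEntropy {ρ : ℝ} (h0 : 0 < ρ) (h1 : ρ < 1) :
    HasDerivAt biasEntropy (-halfLogOdds ρ) ρ := by
  have hi : HasDerivAt (fun x : ℝ => (1 - x) / 2) (-1 / 2) ρ :=
    ((hasDerivAt_id ρ).const_sub 1).div_const 2
  have := (hasDerivAt_binEntropy (p := (1 - ρ) / 2) (by linarith) (by linarith)).comp ρ hi
  refine this.congr_deriv ?_
  have e : 1 - (1 - ρ) / 2 = (1 + ρ) / 2 := by ring
  rw [e, log_div (by linarith) (by norm_num), log_div (by linarith) (by norm_num)]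
  unfold halfLogOdds; ring

lemma biasEntropy_eq {ρ : ℝ} (h0 : 0 ≤ ρ) (h1 : ρ < 1) :
    biasEntropy ρ = log 2 - (log (1 + ρ) + log (1 - ρ)) / 2 - ρ * halfLogOdds ρ := by
  have e : 1 - (1 - ρ) / 2 = (1 + ρ) / 2 := by ring
  unfold biasEntropy halfLogOdds
  rw [binEntropy_eq_negMulLog_add_negMulLog_one_sub, e]
  unfold negMulLog
  rw [log_div (by linarith) (by norm_num), log_div (by linarith) (by norm_num)]
  ring

lemma biasEntropy_eq' {ρ : ℝ} (h0 : 0 ≤ ρ) (h1 : ρ < 1) :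
    biasEntropy ρ = (1 - ρ) * halfLogOdds ρ + (log 2 - log (1 + ρ)) := by
  rw [biasEntropy_eq h0 h1]; unfold halfLogOdds; ring

@[simp] lemma halfLogOdds_zero : halfLogOdds 0 = 0 := by simp [halfLogOdds]

lemma hasDerivAt_halfLogOdds {ρ : ℝ} (h0 : -1 < ρ) (h1 : ρ < 1) :
    HasDerivAt halfLogOdds (1 / (1 - ρ ^ 2)) ρ := by
  have h2 := ((hasDerivAt_id ρ).const_add 1).log (by simp only [id]; linarith)
  have h3 := ((hasDerivAt_id ρ).const_sub 1).log (by simp only [id]; linarith)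
  refine ((h2.sub h3).div_const 2).congr_deriv ?_
  have : 1 + ρ ≠ 0 := by linarith
  have : 1 - ρ ≠ 0 := by linarith
  have : 1 - ρ ^ 2 ≠ 0 := by nlinarith
  simp only [id]
  field_simp
  ring

lemma continuousOn_halfLogOdds : ContinuousOn halfLogOdds (Ico 0 1) := fun _ h =>
  (hasDerivAt_halfLogOdds (by linarith [h.1]) h.2).continuousAt.continuousWithinAt

/-- The first two terms of the power series of `artanh`. -/
lemma add_cube_div_three_le_halfLogOdds {ρ : ℝ} (h0 : 0 ≤ ρ) (h1 : ρ < 1) :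
    ρ + ρ ^ 3 / 3 ≤ halfLogOdds ρ := by
  have hd : ∀ x ∈ Ico (0 : ℝ) 1, HasDerivAt (fun x => halfLogOdds x - (x + x ^ 3 / 3))
      (1 / (1 - x ^ 2) - (1 + x ^ 2)) x := fun x hx => by
    refine ((hasDerivAt_halfLogOdds (by linarith [hx.1]) hx.2).sub
      ((hasDerivAt_id x).add (((hasDerivAt_id x).pow 3).div_const 3))).congr_deriv ?_
    simp
  have hm : MonotoneOn (fun x => halfLogOdds x - (x + x ^ 3 / 3)) (Ico 0 1) := by
    refine monotoneOn_of_deriv_nonneg (convex_Ico 0 1)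
      (fun x hx => (hd x hx).continuousAt.continuousWithinAt)
      (fun x hx => (hd x (interior_subset hx)).differentiableAt.differentiableWithinAt) ?_
    intro x hx
    have hx := interior_subset hx
    rw [(hd x hx).deriv]
    have : 0 < 1 - x ^ 2 := by nlinarith [hx.1, hx.2]
    rw [sub_nonneg, le_div_iff₀ this]
    nlinarith [sq_nonneg (x ^ 2)]
  have := hm ⟨le_rfl, one_pos⟩ ⟨h0, h1⟩ h0
  simp at this
  linarith

lemma le_halfLogOdds {ρ : ℝ} (h0 : 0 ≤ ρ) (h1 : ρ < 1) : ρ ≤ halfLogOdds ρ := by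
  have := add_cube_div_three_le_halfLogOdds h0 h1
  have : 0 ≤ ρ ^ 3 := by positivity
  linarith

lemma halfLogOdds_pos {ρ : ℝ} (h0 : 0 < ρ) (h1 : ρ < 1) : 0 < halfLogOdds ρ :=
  h0.trans_le (le_halfLogOdds h0.le h1)

lemma convexOn_halfLogOdds : ConvexOn ℝ (Ico 0 1) halfLogOdds := by
  refine MonotoneOn.convexOn_of_deriv (convex_Ico 0 1) continuousOn_halfLogOdds
    (fun x hx => ?_) ?_
  · have hx := interior_subset hx
    exact (hasDerivAt_halfLogOdds (by linarith [hx.1]) hx.2).differentiableAt.differentiableWithinAt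
  · intro x hx y hy hxy
    have hx := interior_subset hx
    have hy := interior_subset hy
    rw [(hasDerivAt_halfLogOdds (by linarith [hx.1]) hx.2).deriv,
      (hasDerivAt_halfLogOdds (by linarith [hy.1]) hy.2).deriv]
    have : 0 < 1 - y ^ 2 := by nlinarith [hy.1, hy.2]
    refine one_div_le_one_div_of_le this ?_
    nlinarith [hx.1]

lemma halfLogOdds_mul_le {s ρ : ℝ} (hs0 : 0 ≤ s) (hs1 : s ≤ 1) (h0 : 0 ≤ ρ) (h1 : ρ < 1) :
    halfLogOdds (ρ * s) ≤ s * halfLogOdds ρ := by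
  have := convexOn_halfLogOdds.2 (x := ρ) (y := 0) ⟨h0, h1⟩ ⟨le_rfl, one_pos⟩ hs0
    (sub_nonneg.2 hs1) (by ring)
  simpa [mul_comm] using this

/-- `artanh (ρ σ) / artanh ρ` is antitone in `ρ`; this is what makes `gerber` convex in each
variable. -/
lemma antitoneOn_halfLogOdds_ratio {σ : ℝ} (hs0 : 0 < σ) (hs1 : σ < 1) :
    AntitoneOn (fun ρ => halfLogOdds (ρ * σ) / halfLogOdds ρ) (Ioo 0 1) := by
  -- The elasticity of `artanh` is monotone.
  have hB : MonotoneOn (fun ρ => ρ / ((1 - ρ ^ 2) * halfLogOdds ρ)) (Ioo 0 1) := by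
    have hd : ∀ x ∈ Ioo (0 : ℝ) 1, HasDerivAt (fun ρ => ρ / ((1 - ρ ^ 2) * halfLogOdds ρ))
        (((1 - x ^ 2) * halfLogOdds x - x * (-(2 * x) * halfLogOdds x + 1)) /
          ((1 - x ^ 2) * halfLogOdds x) ^ 2) x := fun x hx => by
      have hw : 1 - x ^ 2 ≠ 0 := by nlinarith [hx.1, hx.2]
      have hA := (halfLogOdds_pos hx.1 hx.2).ne'
      refine ((hasDerivAt_id x).div ((((hasDerivAt_id x).pow 2).const_sub 1).mul
        (hasDerivAt_halfLogOdds (by linarith [hx.1]) hx.2)) (mul_ne_zero hw hA)).congr_deriv ?_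
      simp [hw]
    refine monotoneOn_of_deriv_nonneg (convex_Ioo 0 1)
      (fun x hx => (hd x hx).continuousAt.continuousWithinAt)
      (fun x hx => (hd x (interior_subset hx)).differentiableAt.differentiableWithinAt) ?_
    intro x hx
    have hx := interior_subset hx
    rw [(hd x hx).deriv]
    refine div_nonneg ?_ (sq_nonneg _)
    have := le_halfLogOdds hx.1.le hx.2
    nlinarith [hx.1, hx.2, mul_nonneg (sq_nonneg x) (hx.1.le.trans this)]
  have hd : ∀ x ∈ Ioo (0 : ℝ) 1, HasDerivAt (fun ρ => halfLogOdds (ρ * σ) / halfLogOdds ρ)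
      ((1 / (1 - (x * σ) ^ 2) * σ * halfLogOdds x - halfLogOdds (x * σ) * (1 / (1 - x ^ 2))) /
        halfLogOdds x ^ 2) x := fun x hx => by
    have h1 : x * σ < 1 := by nlinarith [hx.1, hx.2]
    have h0 : 0 < x * σ := mul_pos hx.1 hs0
    exact (((hasDerivAt_halfLogOdds (by linarith) h1).comp x
      (hasDerivAt_mul_const σ)).div
      (hasDerivAt_halfLogOdds (by linarith [hx.1]) hx.2) (halfLogOdds_pos hx.1 hx.2).ne')
  refine antitoneOn_of_deriv_nonpos (convex_Ioo 0 1)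
    (fun x hx => (hd x hx).continuousAt.continuousWithinAt)
    (fun x hx => (hd x (interior_subset hx)).differentiableAt.differentiableWithinAt) ?_
  intro x hx
  have hx := interior_subset hx
  have h0 : 0 < x * σ := mul_pos hx.1 hs0
  have hle : x * σ ≤ x := by nlinarith [hx.1]
  have h1 : x * σ < 1 := hle.trans_lt hx.2
  have := hB ⟨h0, h1⟩ hx hle
  rw [(hd x hx).deriv]
  refine div_nonpos_of_nonpos_of_nonneg ?_ (sq_nonneg _)
  have hw : 0 < 1 - x ^ 2 := by nlinarith [hx.1, hx.2]
  have hw' : 0 < 1 - (x * σ) ^ 2 := by nlinarith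
  have hA := halfLogOdds_pos hx.1 hx.2
  have hA' := halfLogOdds_pos h0 h1
  simp only at this
  rw [div_le_div_iff₀ (by positivity) (by positivity)] at this
  rw [sub_nonpos, div_mul_eq_mul_div, div_mul_eq_mul_div, mul_one_div, div_le_div_iff₀ hw' hw]
  have hx0 := hx.1
  refine le_of_mul_le_mul_left ?_ hx0
  linarith

/-- The elementary inequality behind the ray property at the origin: for
`U ρ = log 2 - log (1 + ρ)`, the function `ρ ↦ U (ρ σ) - σ U ρ - ρ U σ` is concave,
nonnegative at `0` and zero at `1`. -/
lemma log_two_sub_log_mul_ge {ρ σ : ℝ} (hρ0 : 0 ≤ ρ) (hρ1 : ρ ≤ 1) (hσ0 : 0 ≤ σ) (hσ1 : σ ≤ 1) :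
    σ * (log 2 - log (1 + ρ)) + ρ * (log 2 - log (1 + σ)) ≤ log 2 - log (1 + ρ * σ) := by
  set φ : ℝ → ℝ := fun x =>
    (log 2 - log (1 + x * σ)) - (σ * (log 2 - log (1 + x)) + x * (log 2 - log (1 + σ))) with hφ
  have hd : ∀ x ∈ Icc (0 : ℝ) 1, HasDerivAt φ
      (-(σ / (1 + x * σ)) - (σ * -(1 / (1 + x)) + (log 2 - log (1 + σ)))) x := fun x hx => by
    have h1 : 1 + x * σ ≠ 0 := by nlinarith [mul_nonneg hx.1 hσ0]
    have h2 : 1 + x ≠ 0 := by linarith [hx.1]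
    have e1 := (((hasDerivAt_mul_const (x := x) σ).const_add 1).log h1).const_sub (log 2)
    have e2 := ((((hasDerivAt_id x).const_add 1).log h2).const_sub (log 2)).const_mul σ
    exact e1.sub (e2.add (hasDerivAt_mul_const _))
  have hc : ConcaveOn ℝ (Icc 0 1) φ := by
    refine AntitoneOn.concaveOn_of_deriv (convex_Icc 0 1)
      (fun x hx => (hd x hx).continuousAt.continuousWithinAt)
      (fun x hx => (hd x (interior_subset hx)).differentiableAt.differentiableWithinAt) ?_
    intro x hx y hy hxy
    have hx := interior_subset hx
    have hy := interior_subset hy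
    rw [(hd x hx).deriv, (hd y hy).deriv]
    have hx1 : 0 < 1 + x * σ := by nlinarith [mul_nonneg hx.1 hσ0]
    have hy1 : 0 < 1 + y * σ := by nlinarith [mul_nonneg hy.1 hσ0]
    have hx2 : 0 < 1 + x := by linarith [hx.1]
    have hy2 : 0 < 1 + y := by linarith [hy.1]
    have e1 : σ / (1 + x * σ) - σ / (1 + y * σ)
        = σ * (y - x) * (σ / ((1 + x * σ) * (1 + y * σ))) := by
      rw [div_sub_div _ _ hx1.ne' hy1.ne', mul_div_assoc']
      congr 1; ring
    have e2 : σ * (1 / (1 + x)) - σ * (1 / (1 + y))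
        = σ * (y - x) * (1 / ((1 + x) * (1 + y))) := by field_simp; ring
    have key : σ / ((1 + x * σ) * (1 + y * σ)) ≤ 1 / ((1 + x) * (1 + y)) := by
      rw [div_le_div_iff₀ (by positivity) (by positivity)]
      have hxy1 : x * y ≤ 1 := by nlinarith [hx.1, hx.2, hy.1, hy.2]
      nlinarith [mul_nonneg (sub_nonneg.2 hσ1) (show 0 ≤ 1 - x * y * σ by
        nlinarith [mul_nonneg hx.1 hy.1])]
    have := mul_le_mul_of_nonneg_left key (mul_nonneg hσ0 (sub_nonneg.2 hxy))
    linarith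
  have := hc.2 (x := 1) (y := 0) ⟨zero_le_one, le_rfl⟩ ⟨le_rfl, zero_le_one⟩ hρ0
    (sub_nonneg.2 hρ1) (by ring)
  have h1 : φ 1 = 0 := by simp only [hφ]; norm_num
  have h0 : 0 ≤ φ 0 := by
    simp only [hφ]; norm_num
    nlinarith [log_nonneg (one_le_two (α := ℝ))]
  have h3 : 0 ≤ φ ρ := by
    simp [h1] at this
    exact le_trans (mul_nonneg (sub_nonneg.2 hρ1) h0) this
  simp only [hφ] at h3
  linarith

/-- The inequality `x ∂f/∂x + y ∂f/∂y ≤ f` for `f = gerber`, in terms of the biases. Splitting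
`g ρ = (1 - ρ) artanh ρ + U ρ` with `U ρ = log 2 - log (1 + ρ)`, both parts satisfy it. -/
lemma euler_le {ρ σ : ℝ} (hρ0 : 0 < ρ) (hρ1 : ρ < 1) (hσ0 : 0 < σ) (hσ1 : σ < 1) :
    biasEntropy ρ * (σ * halfLogOdds (ρ * σ) / halfLogOdds ρ)
      + biasEntropy σ * (ρ * halfLogOdds (ρ * σ) / halfLogOdds σ) ≤ biasEntropy (ρ * σ) := by
  have hτ0 : 0 < ρ * σ := mul_pos hρ0 hσ0
  have hτ1 : ρ * σ < 1 := by nlinarith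
  rw [biasEntropy_eq' hρ0.le hρ1, biasEntropy_eq' hσ0.le hσ1, biasEntropy_eq' hτ0.le hτ1]
  have hA := halfLogOdds_pos hρ0 hρ1
  have hB := halfLogOdds_pos hσ0 hσ1
  have hC := halfLogOdds_pos hτ0 hτ1
  have a1 : halfLogOdds (ρ * σ) / halfLogOdds ρ ≤ σ :=
    (div_le_iff₀ hA).2 (halfLogOdds_mul_le hσ0.le hσ1.le hρ0.le hρ1)
  have a2 : halfLogOdds (ρ * σ) / halfLogOdds σ ≤ ρ := by
    rw [div_le_iff₀ hB, mul_comm ρ σ]; exact halfLogOdds_mul_le hρ0.le hρ1.le hσ0.le hσ1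
  have hU := log_two_sub_log_mul_ge hρ0.le hρ1.le hσ0.le hσ1.le
  have hUρ : 0 ≤ log 2 - log (1 + ρ) := sub_nonneg.2 (log_le_log (by linarith) (by linarith))
  have hUσ : 0 ≤ log 2 - log (1 + σ) := sub_nonneg.2 (log_le_log (by linarith) (by linarith))
  set a := halfLogOdds ρ
  set b := halfLogOdds σ
  set c := halfLogOdds (ρ * σ)
  set U := log 2 - log (1 + ρ)
  set V := log 2 - log (1 + σ)
  have e1 : ((1 - ρ) * a + U) * (σ * c / a) = (1 - ρ) * σ * c + U * (σ * (c / a)) := by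
    field_simp
  have e2 : ((1 - σ) * b + V) * (ρ * c / b) = (1 - σ) * ρ * c + V * (ρ * (c / b)) := by
    field_simp
  have b1 : U * (σ * (c / a)) ≤ U * σ :=
    mul_le_mul_of_nonneg_left (mul_le_of_le_one_right hσ0.le (a1.trans hσ1.le)) hUρ
  have b2 : V * (ρ * (c / b)) ≤ V * ρ :=
    mul_le_mul_of_nonneg_left (mul_le_of_le_one_right hρ0.le (a2.trans hρ1.le)) hUσ
  have : 0 ≤ c * ((1 - ρ) * (1 - σ)) := by
    have := sub_pos.2 hρ1; have := sub_pos.2 hσ1; positivity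
  rw [e1, e2]
  nlinarith

/-! ### The entropy defect -/

lemma log_two_sub_biasEntropy_le {ρ : ℝ} (h0 : 0 ≤ ρ) (h1 : ρ < 1) :
    2 * (log 2 - biasEntropy ρ) ≤ ρ * halfLogOdds ρ := by
  have hc : ContinuousOn (fun x => x * halfLogOdds x - 2 * (log 2 - biasEntropy x)) (Ico 0 1) :=
    (continuousOn_id.mul continuousOn_halfLogOdds).sub
      (continuousOn_const.mul (continuousOn_const.sub continuous_biasEntropy.continuousOn))
  have hd : ∀ x ∈ Ioo (0 : ℝ) 1, HasDerivAt
      (fun x => x * halfLogOdds x - 2 * (log 2 - biasEntropy x))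
      (x * (1 / (1 - x ^ 2)) - halfLogOdds x) x := fun x hx => by
    refine (((hasDerivAt_id x).mul (hasDerivAt_halfLogOdds (by linarith [hx.1]) hx.2)).sub
      (((hasDerivAt_biasEntropy hx.1 hx.2).const_sub (log 2)).const_mul 2)).congr_deriv ?_
    simp only [id]; ring
  have hd2 : ∀ x ∈ Ico (0 : ℝ) 1, HasDerivAt (fun x => x * (1 / (1 - x ^ 2)) - halfLogOdds x)
      (2 * x ^ 2 / (1 - x ^ 2) ^ 2) x := fun x hx => by
    have hw : 1 - x ^ 2 ≠ 0 := by nlinarith [hx.1, hx.2]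
    have e := ((hasDerivAt_const x (1 : ℝ)).div (((hasDerivAt_id x).pow 2).const_sub 1) hw)
    refine (((hasDerivAt_id x).mul e).sub
      (hasDerivAt_halfLogOdds (by linarith [hx.1]) hx.2)).congr_deriv ?_
    simp
    field_simp
  have hm2 : MonotoneOn (fun x => x * (1 / (1 - x ^ 2)) - halfLogOdds x) (Ico 0 1) := by
    refine monotoneOn_of_deriv_nonneg (convex_Ico 0 1)
      (fun x hx => (hd2 x hx).continuousAt.continuousWithinAt)
      (fun x hx => (hd2 x (interior_subset hx)).differentiableAt.differentiableWithinAt) ?_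
    intro x hx
    rw [(hd2 x (interior_subset hx)).deriv]
    positivity
  have hm : MonotoneOn (fun x => x * halfLogOdds x - 2 * (log 2 - biasEntropy x)) (Ico 0 1) := by
    refine monotoneOn_of_deriv_nonneg (convex_Ico 0 1) hc
      (fun x hx => (hd x (by simpa using hx)).differentiableAt.differentiableWithinAt) ?_
    intro x hx
    have hx : x ∈ Ioo (0 : ℝ) 1 := by simpa using hx
    rw [(hd x hx).deriv]
    have := hm2 ⟨le_rfl, one_pos⟩ ⟨hx.1.le, hx.2⟩ hx.1.le
    simpa using this
  have := hm ⟨le_rfl, one_pos⟩ ⟨h0, h1⟩ h0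
  simp at this
  linarith

/-- In terms of the elasticity `B = ρ / ((1 - ρ²) artanh ρ)` of `artanh` this reads
`2 B² ≤ 1 + B (1 + ρ²) / (1 - ρ²)`. Both sides agree up to order `ρ²`, so that two terms of the power
series of `artanh` are needed. -/
lemma two_le_of_halfLogOdds {ρ : ℝ} (h0 : 0 < ρ) (h1 : ρ < 1) :
    2 * ρ ^ 2 ≤ ((1 - ρ ^ 2) * halfLogOdds ρ) ^ 2 + ρ * (1 + ρ ^ 2) * halfLogOdds ρ := by
  have hA := add_cube_div_three_le_halfLogOdds h0.le h1
  have hw : 0 < 1 - ρ ^ 2 := by nlinarith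
  have hc : 0 ≤ ρ + ρ ^ 3 / 3 := by positivity
  have e1 : ((1 - ρ ^ 2) * (ρ + ρ ^ 3 / 3)) ^ 2 ≤ ((1 - ρ ^ 2) * halfLogOdds ρ) ^ 2 := by
    gcongr
  have e2 : ρ * (1 + ρ ^ 2) * (ρ + ρ ^ 3 / 3) ≤ ρ * (1 + ρ ^ 2) * halfLogOdds ρ := by
    gcongr
  have e3 : ((1 - ρ ^ 2) * (ρ + ρ ^ 3 / 3)) ^ 2 + ρ * (1 + ρ ^ 2) * (ρ + ρ ^ 3 / 3) - 2 * ρ ^ 2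
      = ρ ^ 6 * (1 / 9) + 4 / 9 * ρ ^ 8 + ρ ^ 10 / 9 := by ring
  have : 0 ≤ ρ ^ 6 * (1 / 9) + 4 / 9 * ρ ^ 8 + ρ ^ 10 / 9 := by positivity
  linarith

/-- The ratio of the entropy defect `log 2 - g ρ` to `ρ artanh ρ`. -/
noncomputable def defectRatio (ρ : ℝ) : ℝ := (log 2 - biasEntropy ρ) / (ρ * halfLogOdds ρ)

/-- The function `1 - ρ M'(ρ)` for `M = defectRatio`, see `hasDerivAt_defectRatio`. -/
noncomputable def defectSlope (ρ : ℝ) : ℝ :=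
  defectRatio ρ * (1 + ρ / ((1 - ρ ^ 2) * halfLogOdds ρ))

lemma hasDerivAt_defectRatio {ρ : ℝ} (h0 : 0 < ρ) (h1 : ρ < 1) :
    HasDerivAt defectRatio ((1 - defectSlope ρ) / ρ) ρ := by
  have hA := (halfLogOdds_pos h0 h1).ne'
  have hw : 1 - ρ ^ 2 ≠ 0 := by nlinarith
  have hρ := h0.ne'
  refine ((((hasDerivAt_biasEntropy h0 h1).const_sub (log 2)).div ((hasDerivAt_id ρ).mul
    (hasDerivAt_halfLogOdds (by linarith) h1)) (mul_ne_zero hρ hA))).congr_deriv ?_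
  simp only [defectSlope, defectRatio, id, Pi.mul_apply]
  field_simp

lemma monotoneOn_defectSlope : MonotoneOn defectSlope (Ioo 0 1) := by
  have hd : ∀ x ∈ Ioo (0 : ℝ) 1, HasDerivAt defectSlope
      ((1 - defectSlope x) / x * (1 + x / ((1 - x ^ 2) * halfLogOdds x)) + defectRatio x *
        (((1 - x ^ 2) * halfLogOdds x - x * (-(2 * x) * halfLogOdds x + 1)) /
          ((1 - x ^ 2) * halfLogOdds x) ^ 2)) x := fun x hx => by
    have hw : 1 - x ^ 2 ≠ 0 := by nlinarith [hx.1, hx.2]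
    have hA := (halfLogOdds_pos hx.1 hx.2).ne'
    have e := (hasDerivAt_id x).div ((((hasDerivAt_id x).pow 2).const_sub 1).mul
        (hasDerivAt_halfLogOdds (by linarith [hx.1]) hx.2)) (mul_ne_zero hw hA)
    refine ((hasDerivAt_defectRatio hx.1 hx.2).mul (e.const_add 1)).congr_deriv ?_
    simp [hw]
  refine monotoneOn_of_deriv_nonneg (convex_Ioo 0 1)
    (fun x hx => (hd x hx).continuousAt.continuousWithinAt)
    (fun x hx => (hd x (interior_subset hx)).differentiableAt.differentiableWithinAt) ?_
  intro x hx
  have hx := interior_subset hx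
  rw [(hd x hx).deriv]
  have hx0 := hx.1
  have hA := halfLogOdds_pos hx.1 hx.2
  have hw : 0 < 1 - x ^ 2 := by nlinarith [hx.1, hx.2]
  have hM : defectRatio x ≤ 1 / 2 := by
    rw [defectRatio, div_le_iff₀ (by positivity)]
    linarith [log_two_sub_biasEntropy_le hx.1.le hx.2]
  have hM0 : 0 ≤ defectRatio x :=
    div_nonneg (sub_nonneg.2 (biasEntropy_le_log_two x)) (by positivity)
  have hpoly := two_le_of_halfLogOdds hx.1 hx.2
  have e2 : ((1 - x ^ 2) * halfLogOdds x - x * (-(2 * x) * halfLogOdds x + 1)) /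
          ((1 - x ^ 2) * halfLogOdds x) ^ 2 = (x / ((1 - x ^ 2) * halfLogOdds x) *
          ((1 + x ^ 2) / (1 - x ^ 2)) - (x / ((1 - x ^ 2) * halfLogOdds x)) ^ 2) / x := by
    field_simp
    ring
  have hkey : 2 * (x / ((1 - x ^ 2) * halfLogOdds x)) ^ 2 ≤
      1 + x / ((1 - x ^ 2) * halfLogOdds x) * ((1 + x ^ 2) / (1 - x ^ 2)) := by
    have e3 : 1 + x / ((1 - x ^ 2) * halfLogOdds x) * ((1 + x ^ 2) / (1 - x ^ 2))
        = (((1 - x ^ 2) * halfLogOdds x) ^ 2 + x * (1 + x ^ 2) * halfLogOdds x) /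
          ((1 - x ^ 2) * halfLogOdds x) ^ 2 := by field_simp
    rw [e3, div_pow, ← mul_div_assoc]
    gcongr
  rw [e2, defectSlope]
  have hB : 0 < x / ((1 - x ^ 2) * halfLogOdds x) := by positivity
  set B := x / ((1 - x ^ 2) * halfLogOdds x)
  set M := defectRatio x
  set c := (1 + x ^ 2) / (1 - x ^ 2)
  have e4 : (1 - M * (1 + B)) / x * (1 + B) + M * ((B * c - B ^ 2) / x)
      = ((1 + B) - M * ((1 + B) ^ 2 - B * c + B ^ 2)) / x := by ring
  rw [e4]
  refine div_nonneg ?_ hx0.le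
  rcases le_total 0 ((1 + B) ^ 2 - B * c + B ^ 2) with h | h
  -- The worst case is `M = 1 / 2`, where `hkey` is the claim.
  · nlinarith [mul_le_mul_of_nonneg_right hM h]
  · nlinarith [mul_nonneg_of_nonpos_of_nonpos h (neg_nonpos.2 hM0)]

lemma tendsto_halfLogOdds_atTop : Tendsto halfLogOdds (𝓝[<] 1) atTop := by
  have h1 : Tendsto (fun x : ℝ => 1 - x) (𝓝[<] 1) (𝓝[>] 0) := by
    refine tendsto_nhdsWithin_iff.2 ⟨?_, ?_⟩
    · have : Continuous fun x : ℝ => 1 - x := by fun_prop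
      simpa using (this.tendsto 1).mono_left nhdsWithin_le_nhds
    · filter_upwards [self_mem_nhdsWithin] with x hx
      simpa using hx
  have h2 := tendsto_neg_atBot_atTop.comp (tendsto_log_nhdsGT_zero.comp h1)
  have h3 : Tendsto (fun x : ℝ => log (1 + x)) (𝓝[<] 1) (𝓝 (log (1 + 1))) :=
    ((continuousAt_const.add continuousAt_id).log (by norm_num)).tendsto.mono_left
      nhdsWithin_le_nhds
  have := (h3.add_atTop h2).atTop_div_const (zero_lt_two)
  refine this.congr fun x => ?_
  simp [halfLogOdds, sub_eq_add_neg]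

/-- `M (ρ σ) ≤ M ρ + M σ` for `M = defectRatio`: in logarithmic scale the slope of `M` is monotone,
and `M` vanishes at `1`. -/
lemma defectRatio_mul_le {ρ σ : ℝ} (hρ0 : 0 < ρ) (hρ1 : ρ < 1) (hσ0 : 0 < σ) (hσ1 : σ < 1) :
    defectRatio (ρ * σ) ≤ defectRatio ρ + defectRatio σ := by
  have hmul : ∀ x ∈ Ioo (0 : ℝ) 1, x * σ ∈ Ioo (0 : ℝ) 1 := fun x hx =>
    ⟨mul_pos hx.1 hσ0, by nlinarith [hx.1, hx.2]⟩
  have hd : ∀ x ∈ Ioo (0 : ℝ) 1,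
      HasDerivAt (fun x => defectRatio x + defectRatio σ - defectRatio (x * σ))
      ((1 - defectSlope x) / x - (1 - defectSlope (x * σ)) / (x * σ) * σ) x := fun x hx =>
    ((hasDerivAt_defectRatio hx.1 hx.2).add_const _).sub
      (HasDerivAt.comp (h₂ := defectRatio) (h := fun x => x * σ) x
        (hasDerivAt_defectRatio (hmul x hx).1 (hmul x hx).2) (hasDerivAt_mul_const σ))
  have hm : AntitoneOn (fun x => defectRatio x + defectRatio σ - defectRatio (x * σ))
      (Ioo 0 1) := by
    refine antitoneOn_of_deriv_nonpos (convex_Ioo 0 1)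
      (fun x hx => (hd x hx).continuousAt.continuousWithinAt)
      (fun x hx => (hd x (interior_subset hx)).differentiableAt.differentiableWithinAt) ?_
    intro x hx
    have hx := interior_subset hx
    rw [(hd x hx).deriv]
    have := monotoneOn_defectSlope (hmul x hx) hx (by nlinarith [hx.1])
    have e : (1 - defectSlope x) / x - (1 - defectSlope (x * σ)) / (x * σ) * σ
        = (defectSlope (x * σ) - defectSlope x) / x := by
      have := hx.1.ne'
      field_simp
      ring
    rw [e]
    exact div_nonpos_of_nonpos_of_nonneg (by linarith) hx.1.le
  have hlim1 : Tendsto defectRatio (𝓝[<] 1) (𝓝 0) := by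
    have hnum : Tendsto (fun x => log 2 - biasEntropy x) (𝓝[<] 1) (𝓝 (log 2 - biasEntropy 1)) :=
      ((continuous_const.sub continuous_biasEntropy).tendsto 1).mono_left nhdsWithin_le_nhds
    refine hnum.div_atTop ?_
    have : Tendsto (fun x : ℝ => x) (𝓝[<] 1) (𝓝 1) := nhdsWithin_le_nhds
    exact this.pos_mul_atTop one_pos tendsto_halfLogOdds_atTop
  have hlim2 : Tendsto (fun x => defectRatio (x * σ)) (𝓝[<] 1) (𝓝 (defectRatio σ)) := by
    have hc : ContinuousAt defectRatio (1 * σ) := by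
      rw [one_mul]; exact (hasDerivAt_defectRatio hσ0 hσ1).continuousAt
    have := (ContinuousAt.comp (f := fun x : ℝ => x * σ) hc (by fun_prop)).tendsto
    simp only [Function.comp_def, one_mul] at this
    exact this.mono_left nhdsWithin_le_nhds
  have hlim := (hlim1.add_const (defectRatio σ)).sub hlim2
  rw [zero_add, sub_self] at hlim
  have : 0 ≤ defectRatio ρ + defectRatio σ - defectRatio (ρ * σ) := by
    refine le_of_tendsto hlim ?_
    filter_upwards [Ioo_mem_nhdsLT hρ1] with x hx
    exact hm ⟨hρ0, hρ1⟩ ⟨hρ0.trans hx.1, hx.2⟩ hx.1.le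
  linarith

/-- The inequality `d ≤ u ∂d/∂u + v ∂d/∂v` for the defect `d = log 2 - f` of `f = gerber` as a
function of `u = log 2 - x` and `v = log 2 - y`, in terms of the biases. -/
lemma euler_ge {ρ σ : ℝ} (hρ0 : 0 < ρ) (hρ1 : ρ < 1) (hσ0 : 0 < σ) (hσ1 : σ < 1) :
    log 2 - biasEntropy (ρ * σ) ≤
    (log 2 - biasEntropy ρ) * (σ * halfLogOdds (ρ * σ) / halfLogOdds ρ)
      + (log 2 - biasEntropy σ) * (ρ * halfLogOdds (ρ * σ) / halfLogOdds σ) := by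
  have hτ0 : 0 < ρ * σ := mul_pos hρ0 hσ0
  have hτ1 : ρ * σ < 1 := by nlinarith
  have hA := halfLogOdds_pos hρ0 hρ1
  have hB := halfLogOdds_pos hσ0 hσ1
  have hC := halfLogOdds_pos hτ0 hτ1
  have := mul_le_mul_of_nonneg_right (defectRatio_mul_le hρ0 hρ1 hσ0 hσ1) (mul_pos hτ0 hC).le
  unfold defectRatio at this
  rw [div_mul_cancel₀ _ (mul_pos hτ0 hC).ne'] at this
  refine this.trans_eq ?_
  field_simp

/-! ### Mrs. Gerber's function for bits -/

/-- The bias in `[0, 1]` of a bit whose entropy is `x`, where `x` is first clamped to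
`[0, log 2]`. -/
noncomputable def bias (x : ℝ) : ℝ :=
  Function.invFunOn biasEntropy (Icc 0 1) (max 0 (min x (log 2)))

lemma log_two_pos : 0 < log 2 := log_pos one_lt_two

lemma clamp_mem_image (x : ℝ) : max 0 (min x (log 2)) ∈ biasEntropy '' Icc 0 1 := by
  have := intermediate_value_Icc' (zero_le_one' ℝ) continuous_biasEntropy.continuousOn
  rw [biasEntropy_one, biasEntropy_zero] at this
  exact this ⟨le_max_left _ _, max_le log_two_pos.le (min_le_right _ _)⟩

lemma bias_mem (x : ℝ) : bias x ∈ Icc (0 : ℝ) 1 := Function.invFunOn_mem (clamp_mem_image x)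

lemma biasEntropy_bias_clamp (x : ℝ) : biasEntropy (bias x) = max 0 (min x (log 2)) :=
  Function.invFunOn_eq (clamp_mem_image x)

lemma biasEntropy_bias {x : ℝ} (hx : x ∈ Icc 0 (log 2)) : biasEntropy (bias x) = x := by
  rw [biasEntropy_bias_clamp, min_eq_left hx.2, max_eq_right hx.1]

lemma bias_biasEntropy {ρ : ℝ} (h : ρ ∈ Icc (0 : ℝ) 1) : bias (biasEntropy ρ) = ρ :=
  strictAntiOn_biasEntropy.injOn (bias_mem _) h
    (biasEntropy_bias ⟨biasEntropy_nonneg h.1 h.2, biasEntropy_le_log_two ρ⟩)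

lemma antitone_bias : Antitone bias := by
  intro x y hxy
  by_contra! h
  have := strictAntiOn_biasEntropy (bias_mem x) (bias_mem y) h
  rw [biasEntropy_bias_clamp, biasEntropy_bias_clamp] at this
  exact absurd this (not_lt.2 (max_le_max_left 0 (min_le_min_right _ hxy)))

lemma bias_of_nonpos {x : ℝ} (hx : x ≤ 0) : bias x = 1 :=
  strictAntiOn_biasEntropy.injOn (bias_mem x) ⟨zero_le_one, le_rfl⟩ <| by
    rw [biasEntropy_bias_clamp, biasEntropy_one, max_eq_left ((min_le_left _ _).trans hx)]

lemma bias_of_log_two_le {x : ℝ} (hx : log 2 ≤ x) : bias x = 0 :=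
  strictAntiOn_biasEntropy.injOn (bias_mem x) ⟨le_rfl, zero_le_one⟩ <| by
    rw [biasEntropy_bias_clamp, biasEntropy_zero, min_eq_right hx, max_eq_right log_two_pos.le]

lemma bias_mem_Ioo {x : ℝ} (hx : x ∈ Ioo 0 (log 2)) : bias x ∈ Ioo (0 : ℝ) 1 := by
  have h := biasEntropy_bias (Ioo_subset_Icc_self hx)
  refine ⟨(bias_mem x).1.lt_of_ne fun e => ?_, (bias_mem x).2.lt_of_ne fun e => ?_⟩
  · rw [← e, biasEntropy_zero] at h
    exact hx.2.ne h.symm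
  · rw [e, biasEntropy_one] at h
    exact hx.1.ne h

lemma continuous_bias : Continuous bias := by
  have h : Continuous fun x => OrderDual.toDual (⟨bias x, bias_mem x⟩ : Icc (0 : ℝ) 1) := by
    refine Monotone.continuous_of_surjective (fun x y hxy => antitone_bias hxy) fun ρ => ?_
    exact ⟨biasEntropy (OrderDual.ofDual ρ).1, congrArg OrderDual.toDual
      (Subtype.ext (bias_biasEntropy (OrderDual.ofDual ρ).2))⟩
  exact continuous_subtype_val.comp (continuous_ofDual.comp h)

lemma hasDerivAt_bias {x : ℝ} (hx : x ∈ Ioo 0 (log 2)) :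
    HasDerivAt bias (-halfLogOdds (bias x))⁻¹ x := by
  have h := bias_mem_Ioo hx
  refine HasDerivAt.of_local_left_inverse continuous_bias.continuousAt
    (hasDerivAt_biasEntropy h.1 h.2) (neg_ne_zero.2 (halfLogOdds_pos h.1 h.2).ne') ?_
  filter_upwards [Icc_mem_nhds hx.1 hx.2] with y hy using biasEntropy_bias hy

/-- Mrs. Gerber's function: the entropy of the sum of two independent bits of entropies `x` and
`y`, both clamped to `[0, log 2]`. -/
noncomputable def gerber (x y : ℝ) : ℝ := biasEntropy (bias x * bias y)

lemma gerber_comm (x y : ℝ) : gerber x y = gerber y x := by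
  rw [gerber, gerber, mul_comm]

lemma bias_mul_mem (x y : ℝ) : bias x * bias y ∈ Icc (0 : ℝ) 1 :=
  ⟨mul_nonneg (bias_mem x).1 (bias_mem y).1,
    mul_le_one₀ (bias_mem x).2 (bias_mem y).1 (bias_mem y).2⟩

lemma gerber_mono_left (y : ℝ) : Monotone fun x => gerber x y := fun x x' h =>
  strictAntiOn_biasEntropy.antitoneOn (bias_mul_mem x' y) (bias_mul_mem x y)
    (mul_le_mul_of_nonneg_right (antitone_bias h) (bias_mem y).1)

lemma gerber_le_log_two (x y : ℝ) : gerber x y ≤ log 2 := biasEntropy_le_log_two _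

lemma gerber_nonneg (x y : ℝ) : 0 ≤ gerber x y :=
  biasEntropy_nonneg (bias_mul_mem x y).1 (bias_mul_mem x y).2

lemma gerber_of_nonpos {x y : ℝ} (hx : x ≤ 0) (hy : y ∈ Icc 0 (log 2)) : gerber x y = y := by
  rw [gerber, bias_of_nonpos hx, one_mul, biasEntropy_bias hy]

lemma gerber_of_log_two_le {x : ℝ} (hx : log 2 ≤ x) (y : ℝ) : gerber x y = log 2 := by
  rw [gerber, bias_of_log_two_le hx, zero_mul, biasEntropy_zero]

lemma gerber_of_nonpos_nonpos {x y : ℝ} (hx : x ≤ 0) (hy : y ≤ 0) : gerber x y = 0 := by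
  rw [gerber, bias_of_nonpos hx, bias_of_nonpos hy, one_mul, biasEntropy_one]

lemma le_gerber_right (x : ℝ) {y : ℝ} (hy : y ≤ log 2) : y ≤ gerber x y := by
  have h : biasEntropy (bias y) ≤ gerber x y :=
    strictAntiOn_biasEntropy.antitoneOn (bias_mul_mem x y) (bias_mem y)
      (mul_le_of_le_one_left (bias_mem y).1 (bias_mem x).2)
  rw [biasEntropy_bias_clamp, min_eq_left hy] at h
  exact (le_max_right _ _).trans h

lemma le_gerber_left {x : ℝ} (hx : x ≤ log 2) (y : ℝ) : x ≤ gerber x y := by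
  rw [gerber_comm]; exact le_gerber_right y hx

lemma continuous_gerber : Continuous fun z : ℝ × ℝ => gerber z.1 z.2 :=
  continuous_biasEntropy.comp ((continuous_bias.comp continuous_fst).mul
    (continuous_bias.comp continuous_snd))

/-- The partial derivative of `gerber` in its first variable, on the open square. -/
noncomputable def gerberSlope (x y : ℝ) : ℝ :=
  bias y * halfLogOdds (bias x * bias y) / halfLogOdds (bias x)

/-- The chain rule for `gerber` along a curve in the open square. -/
lemma hasDerivAt_gerber_comp {X Y : ℝ → ℝ} {X' Y' t : ℝ} (hX : HasDerivAt X X' t)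
    (hY : HasDerivAt Y Y' t) (hx : X t ∈ Ioo 0 (log 2)) (hy : Y t ∈ Ioo 0 (log 2)) :
    HasDerivAt (fun t => gerber (X t) (Y t))
      (gerberSlope (X t) (Y t) * X' + gerberSlope (Y t) (X t) * Y') t := by
  have hbx := bias_mem_Ioo hx
  have hby := bias_mem_Ioo hy
  have h0 : 0 < bias (X t) * bias (Y t) := mul_pos hbx.1 hby.1
  have h1 : bias (X t) * bias (Y t) < 1 :=
    mul_lt_one_of_nonneg_of_lt_one_left hbx.1.le hbx.2 hby.2.le
  have e := ((hasDerivAt_bias hx).comp t hX).mul ((hasDerivAt_bias hy).comp t hY)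
  have := HasDerivAt.comp (h₂ := biasEntropy) (h := fun t => bias (X t) * bias (Y t)) t
    (hasDerivAt_biasEntropy h0 h1) e
  refine this.congr_deriv ?_
  have := (halfLogOdds_pos hbx.1 hbx.2).ne'
  have := (halfLogOdds_pos hby.1 hby.2).ne'
  simp only [gerberSlope, mul_comm (bias (Y t)) (bias (X t)), Function.comp_apply]
  field_simp
  ring

lemma hasDerivAt_gerber_left {x y : ℝ} (hx : x ∈ Ioo 0 (log 2)) (hy : y ∈ Ioo 0 (log 2)) :
    HasDerivAt (fun x => gerber x y) (gerberSlope x y) x := by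
  simpa using hasDerivAt_gerber_comp (hasDerivAt_id x) (hasDerivAt_const x y) hx hy

/-- Mrs. Gerber's Lemma for the group of order two. -/
lemma convexOn_gerber_left {y : ℝ} (hy : y ∈ Icc 0 (log 2)) :
    ConvexOn ℝ (Icc 0 (log 2)) fun x => gerber x y := by
  rcases hy.1.eq_or_lt with rfl | hy0
  · refine (convexOn_id (convex_Icc 0 (log 2))).congr fun x hx => ?_
    rw [gerber_comm, gerber_of_nonpos le_rfl hx]; rfl
  rcases hy.2.eq_or_lt with rfl | hy1
  · refine (convexOn_const (log 2) (convex_Icc 0 (log 2))).congr fun x hx => ?_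
    rw [gerber_comm, gerber_of_log_two_le le_rfl]
  have hy' : y ∈ Ioo 0 (log 2) := ⟨hy0, hy1⟩
  have hbias := bias_mem_Ioo hy'
  refine MonotoneOn.convexOn_of_deriv (convex_Icc _ _)
    (continuous_gerber.comp (Continuous.prodMk continuous_id continuous_const)).continuousOn
    (fun x hx => ?_) ?_
  · rw [interior_Icc] at hx
    exact (hasDerivAt_gerber_left hx hy').differentiableAt.differentiableWithinAt
  · rw [interior_Icc]
    intro x hx x' hx' hxx
    rw [(hasDerivAt_gerber_left hx hy').deriv, (hasDerivAt_gerber_left hx' hy').deriv]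
    have := antitoneOn_halfLogOdds_ratio hbias.1 hbias.2 (bias_mem_Ioo hx') (bias_mem_Ioo hx)
      (antitone_bias hxx)
    simp only [gerberSlope, mul_div_assoc]
    exact mul_le_mul_of_nonneg_left this hbias.1.le

/-- The graph of `gerber` lies above its tangents in the first variable. -/
lemma gerber_tangent_le {x y x' : ℝ} (hx : x ∈ Ioo 0 (log 2)) (hy : y ∈ Ioo 0 (log 2))
    (hx' : x' ∈ Icc 0 (log 2)) :
    gerber x y + gerberSlope x y * (x' - x) ≤ gerber x' y := by
  have hc := convexOn_gerber_left (Ioo_subset_Icc_self hy)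
  have hd := hasDerivAt_gerber_left hx hy
  rcases lt_trichotomy x x' with h | rfl | h
  · have := hc.le_slope_of_hasDerivAt (Ioo_subset_Icc_self hx) hx' h hd
    rw [slope_def_field, le_div_iff₀ (sub_pos.2 h)] at this
    linarith
  · simp
  · have := hc.slope_le_of_hasDerivAt hx' (Ioo_subset_Icc_self hx) h hd
    rw [slope_def_field, div_le_iff₀ (sub_pos.2 h)] at this
    linarith

lemma gerberSlope_euler_le {x y : ℝ} (hx : x ∈ Ioo 0 (log 2)) (hy : y ∈ Ioo 0 (log 2)) :
    x * gerberSlope x y + y * gerberSlope y x ≤ gerber x y := by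
  have hbx := bias_mem_Ioo hx
  have hby := bias_mem_Ioo hy
  have := euler_le hbx.1 hbx.2 hby.1 hby.2
  rw [biasEntropy_bias (Ioo_subset_Icc_self hx), biasEntropy_bias (Ioo_subset_Icc_self hy)] at this
  simpa only [gerberSlope, gerber, mul_comm (bias y) (bias x)] using this

lemma gerberSlope_euler_ge {x y : ℝ} (hx : x ∈ Ioo 0 (log 2)) (hy : y ∈ Ioo 0 (log 2)) :
    log 2 - gerber x y ≤ (log 2 - x) * gerberSlope x y + (log 2 - y) * gerberSlope y x := by
  have hbx := bias_mem_Ioo hx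
  have hby := bias_mem_Ioo hy
  have := euler_ge hbx.1 hbx.2 hby.1 hby.2
  rw [biasEntropy_bias (Ioo_subset_Icc_self hx), biasEntropy_bias (Ioo_subset_Icc_self hy)] at this
  simpa only [gerberSlope, gerber, mul_comm (bias y) (bias x)] using this

/-- If `t ψ' ≤ ψ`, then `ψ t / t` is antitone. -/
lemma mul_le_of_euler {ψ ψ' : ℝ → ℝ} (hc : Continuous ψ) (h0 : 0 ≤ ψ 0)
    (hd : ∀ t ∈ Ioo (0 : ℝ) 1, HasDerivAt ψ (ψ' t) t)
    (he : ∀ t ∈ Ioo (0 : ℝ) 1, t * ψ' t ≤ ψ t) {t : ℝ} (ht : t ∈ Icc (0 : ℝ) 1) :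
    t * ψ 1 ≤ ψ t := by
  rcases ht.1.eq_or_lt with rfl | ht0
  · simpa using h0
  have hd' : ∀ t ∈ Ioo (0 : ℝ) 1, HasDerivAt (fun t => ψ t / t) ((ψ' t * t - ψ t * 1) / t ^ 2) t :=
    fun t ht => (hd t ht).div (hasDerivAt_id t) ht.1.ne'
  have : AntitoneOn (fun t => ψ t / t) (Ioc 0 1) := by
    refine antitoneOn_of_deriv_nonpos (convex_Ioc 0 1)
      (hc.continuousOn.div continuousOn_id fun t ht => ht.1.ne') ?_ ?_
    · rw [interior_Ioc]
      exact fun t ht => (hd' t ht).differentiableAt.differentiableWithinAt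
    · rw [interior_Ioc]
      intro t ht
      rw [(hd' t ht).deriv]
      exact div_nonpos_of_nonpos_of_nonneg (by linarith [he t ht]) (sq_nonneg t)
  have := this ⟨ht0, ht.2⟩ ⟨one_pos, le_rfl⟩ ht.2
  simp only [div_one] at this
  rw [le_div_iff₀ ht0] at this
  linarith

lemma mul_mem_Ioo {x t c : ℝ} (hx : x ∈ Ioc 0 c) (ht : t ∈ Ioo (0 : ℝ) 1) : t * x ∈ Ioo 0 c :=
  ⟨mul_pos ht.1 hx.1, by nlinarith [ht.2, hx.1, hx.2]⟩

/-- `gerber` is star-shaped along rays from the origin. -/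
lemma mul_gerber_le {x y t : ℝ} (hx : x ∈ Icc 0 (log 2)) (hy : y ∈ Icc 0 (log 2))
    (ht : t ∈ Icc (0 : ℝ) 1) : t * gerber x y ≤ gerber (t * x) (t * y) := by
  have hmul : ∀ z ∈ Icc 0 (log 2), t * z ∈ Icc 0 (log 2) := fun z hz =>
    ⟨mul_nonneg ht.1 hz.1, (mul_le_of_le_one_left hz.1 ht.2).trans hz.2⟩
  rcases hx.1.eq_or_lt with rfl | hx0
  · rw [mul_zero, gerber_of_nonpos le_rfl hy, gerber_of_nonpos le_rfl (hmul y hy)]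
  rcases hy.1.eq_or_lt with rfl | hy0
  · rw [mul_zero, gerber_comm, gerber_comm _ 0, gerber_of_nonpos le_rfl hx,
      gerber_of_nonpos le_rfl (hmul x hx)]
  have := mul_le_of_euler (ψ := fun t => gerber (t * x) (t * y))
    (ψ' := fun t => gerberSlope (t * x) (t * y) * x + gerberSlope (t * y) (t * x) * y)
    (continuous_gerber.comp (by fun_prop : Continuous fun t : ℝ => (t * x, t * y)))
    (gerber_nonneg _ _)
    (fun t ht => hasDerivAt_gerber_comp (hasDerivAt_mul_const x) (hasDerivAt_mul_const y)
      (mul_mem_Ioo ⟨hx0, hx.2⟩ ht) (mul_mem_Ioo ⟨hy0, hy.2⟩ ht))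
    (fun t ht => by
      have := gerberSlope_euler_le (mul_mem_Ioo ⟨hx0, hx.2⟩ ht) (mul_mem_Ioo ⟨hy0, hy.2⟩ ht)
      linarith) ht
  simpa using this

/-- `gerber` is star-shaped along rays from the corner `(log 2, log 2)`, in the opposite sense. -/
lemma mul_gerber_corner_le {u v t : ℝ} (hu : u ∈ Icc 0 (log 2)) (hv : v ∈ Icc 0 (log 2))
    (ht : t ∈ Icc (0 : ℝ) 1) :
    t * (gerber (log 2 - u) (log 2 - v) - log 2)
      ≤ gerber (log 2 - t * u) (log 2 - t * v) - log 2 := by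
  rcases hu.1.eq_or_lt with rfl | hu0
  · simp [gerber_of_log_two_le]
  rcases hv.1.eq_or_lt with rfl | hv0
  · simp [gerber_of_log_two_le, gerber_comm _ (log 2)]
  have hmem : ∀ z ∈ Ioo 0 (log 2), log 2 - z ∈ Ioo 0 (log 2) := fun z hz =>
    ⟨sub_pos.2 hz.2, sub_lt_self _ hz.1⟩
  have hu1 : ∀ t ∈ Ioo (0 : ℝ) 1, log 2 - t * u ∈ Ioo 0 (log 2) := fun t ht =>
    hmem _ (mul_mem_Ioo ⟨hu0, hu.2⟩ ht)
  have hv1 : ∀ t ∈ Ioo (0 : ℝ) 1, log 2 - t * v ∈ Ioo 0 (log 2) := fun t ht =>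
    hmem _ (mul_mem_Ioo ⟨hv0, hv.2⟩ ht)
  have := mul_le_of_euler (ψ := fun t => gerber (log 2 - t * u) (log 2 - t * v) - log 2)
    (ψ' := fun t => gerberSlope (log 2 - t * u) (log 2 - t * v) * -u
      + gerberSlope (log 2 - t * v) (log 2 - t * u) * -v)
    ((continuous_gerber.comp (by fun_prop :
      Continuous fun t : ℝ => (log 2 - t * u, log 2 - t * v))).sub continuous_const)
    (by simp [gerber_of_log_two_le])
    (fun t ht => (hasDerivAt_gerber_comp ((hasDerivAt_mul_const u).const_sub _)
      ((hasDerivAt_mul_const v).const_sub _) (hu1 t ht) (hv1 t ht)).sub_const _)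
    (fun t ht => by
      have := gerberSlope_euler_ge (hu1 t ht) (hv1 t ht)
      linarith) ht
  simpa using this

/-- Let `φ` be star-shaped along rays from the origin of the unit square and, on the two sides
through `(1, 1)`, lie above lines of slopes `c₁`, `c₂` with value `D` at `(1, 1)`. If
`c₁ + c₂ ≤ D`, then `φ a b ≥ a * (D - c₂) + b * c₂`: on these two sides directly, elsewhere
along rays. Adding this bound at two opposite points gives `D`. -/
lemma le_add_of_starShaped {φ : ℝ → ℝ → ℝ} {c₁ c₂ D : ℝ} (h0 : 0 ≤ φ 0 0)
    (hstar : ∀ a ∈ Icc (0 : ℝ) 1, ∀ b ∈ Icc (0 : ℝ) 1, ∀ t ∈ Icc (0 : ℝ) 1,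
      t * φ a b ≤ φ (t * a) (t * b))
    (h1 : ∀ a ∈ Icc (0 : ℝ) 1, D - (1 - a) * c₁ ≤ φ a 1)
    (h2 : ∀ b ∈ Icc (0 : ℝ) 1, D - (1 - b) * c₂ ≤ φ 1 b)
    (hc : c₁ + c₂ ≤ D) {a b : ℝ} (ha : a ∈ Icc (0 : ℝ) 1) (hb : b ∈ Icc (0 : ℝ) 1) :
    D ≤ φ a b + φ (1 - a) (1 - b) := by
  have key : ∀ a ∈ Icc (0 : ℝ) 1, ∀ b ∈ Icc (0 : ℝ) 1, a * (D - c₂) + b * c₂ ≤ φ a b := by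
    intro a ha b hb
    rcases le_total b a with hba | hab
    · rcases ha.1.eq_or_lt with rfl | ha0
      · obtain rfl := le_antisymm hba hb.1
        simpa using h0
      have hm : b / a ∈ Icc (0 : ℝ) 1 := ⟨div_nonneg hb.1 ha.1, (div_le_one ha0).2 hba⟩
      have e1 := hstar 1 ⟨zero_le_one, le_rfl⟩ (b / a) hm a ha
      rw [mul_one, mul_div_cancel₀ b ha0.ne'] at e1
      have e2 := mul_le_mul_of_nonneg_left (h2 _ hm) ha.1
      have e3 : a * (D - (1 - b / a) * c₂) = a * (D - c₂) + b * c₂ := by field_simp; ring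
      linarith
    · rcases hb.1.eq_or_lt with rfl | hb0
      · obtain rfl := le_antisymm hab ha.1
        simpa using h0
      have hm : a / b ∈ Icc (0 : ℝ) 1 := ⟨div_nonneg ha.1 hb.1, (div_le_one hb0).2 hab⟩
      have e1 := hstar (a / b) hm 1 ⟨zero_le_one, le_rfl⟩ b hb
      rw [mul_one, mul_div_cancel₀ a hb0.ne'] at e1
      have e2 := mul_le_mul_of_nonneg_left (h1 _ hm) hb.1
      have e3 : b * (D - (1 - a / b) * c₁) = b * D - (b - a) * c₁ := by field_simp
      nlinarith [sub_nonneg.2 hab]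
  have := key a ha b hb
  have := key (1 - a) ⟨sub_nonneg.2 ha.2, sub_le_self _ ha.1⟩ (1 - b)
    ⟨sub_nonneg.2 hb.2, sub_le_self _ hb.1⟩
  linarith

lemma mul_mem_Icc {x t c : ℝ} (hx : x ∈ Icc 0 c) (ht : t ∈ Icc (0 : ℝ) 1) : t * x ∈ Icc 0 c :=
  ⟨mul_nonneg ht.1 hx.1, (mul_le_of_le_one_left hx.1 ht.2).trans hx.2⟩

lemma gerber_le_add_of_mul {x y a b : ℝ} (hx : x ∈ Ioo 0 (log 2)) (hy : y ∈ Ioo 0 (log 2))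
    (ha : a ∈ Icc (0 : ℝ) 1) (hb : b ∈ Icc (0 : ℝ) 1) :
    gerber x y ≤ gerber (a * x) (b * y) + gerber ((1 - a) * x) ((1 - b) * y) := by
  have hx' := Ioo_subset_Icc_self hx
  have hy' := Ioo_subset_Icc_self hy
  refine le_add_of_starShaped (φ := fun a b => gerber (a * x) (b * y))
    (c₁ := x * gerberSlope x y) (c₂ := y * gerberSlope y x) (gerber_nonneg _ _) ?_ ?_ ?_
    (gerberSlope_euler_le hx hy) ha hb
  · intro a ha b hb t ht
    simpa only [mul_assoc] using mul_gerber_le (mul_mem_Icc hx' ha) (mul_mem_Icc hy' hb) ht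
  · intro a ha
    have := gerber_tangent_le hx hy (mul_mem_Icc hx' ha)
    rw [one_mul]; linarith
  · intro b hb
    have := gerber_tangent_le hy hx (mul_mem_Icc hy' hb)
    rw [one_mul, gerber_comm x, gerber_comm x]; linarith

lemma gerber_corner_le_add_of_mul {u v a b : ℝ} (hu : u ∈ Ioo 0 (log 2)) (hv : v ∈ Ioo 0 (log 2))
    (ha : a ∈ Icc (0 : ℝ) 1) (hb : b ∈ Icc (0 : ℝ) 1) :
    gerber (log 2 - u) (log 2 - v) + log 2 ≤ gerber (log 2 - a * u) (log 2 - b * v)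
      + gerber (log 2 - (1 - a) * u) (log 2 - (1 - b) * v) := by
  have hu' := Ioo_subset_Icc_self hu
  have hv' := Ioo_subset_Icc_self hv
  have hx : log 2 - u ∈ Ioo 0 (log 2) := ⟨sub_pos.2 hu.2, sub_lt_self _ hu.1⟩
  have hy : log 2 - v ∈ Ioo 0 (log 2) := ⟨sub_pos.2 hv.2, sub_lt_self _ hv.1⟩
  have hsub : ∀ z ∈ Icc 0 (log 2), log 2 - z ∈ Icc 0 (log 2) := fun z hz =>
    ⟨sub_nonneg.2 hz.2, sub_le_self _ hz.1⟩
  have := le_add_of_starShaped (φ := fun a b => gerber (log 2 - a * u) (log 2 - b * v) - log 2)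
    (c₁ := -u * gerberSlope (log 2 - u) (log 2 - v))
    (c₂ := -v * gerberSlope (log 2 - v) (log 2 - u))
    (D := gerber (log 2 - u) (log 2 - v) - log 2) (by simp [gerber_of_log_two_le]) ?_ ?_ ?_
    (by linarith [gerberSlope_euler_ge hx hy]) ha hb
  · linarith
  · intro a ha b hb t ht
    simpa only [mul_assoc] using mul_gerber_corner_le (mul_mem_Icc hu' ha) (mul_mem_Icc hv' hb) ht
  · intro a ha
    have := gerber_tangent_le hx hy (hsub _ (mul_mem_Icc hu' ha))
    rw [one_mul]; linarith
  · intro b hb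
    have := gerber_tangent_le hy hx (hsub _ (mul_mem_Icc hv' hb))
    rw [one_mul, gerber_comm (log 2 - u), gerber_comm (log 2 - u)]; linarith

/-- Subadditivity of `gerber` as long as both sums stay within one bit. -/
lemma gerber_add_le {u v s t : ℝ} (hu : 0 ≤ u) (hv : 0 ≤ v) (hs : 0 ≤ s) (ht : 0 ≤ t)
    (hus : u + s ≤ log 2) (hvt : v + t ≤ log 2) :
    gerber (u + s) (v + t) ≤ gerber u v + gerber s t := by
  have l1 := le_gerber_left (by linarith : u ≤ log 2) v
  have l2 := le_gerber_right u (by linarith : v ≤ log 2)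
  have l3 := le_gerber_left (by linarith : s ≤ log 2) t
  have l4 := le_gerber_right s (by linarith : t ≤ log 2)
  rcases (add_nonneg hu hs).eq_or_lt with h | hx0
  · rw [← h, gerber_of_nonpos le_rfl ⟨add_nonneg hv ht, hvt⟩]; linarith
  rcases (add_nonneg hv ht).eq_or_lt with h | hy0
  · rw [← h, gerber_comm, gerber_of_nonpos le_rfl ⟨add_nonneg hu hs, hus⟩]; linarith
  rcases hus.eq_or_lt with h | hx1
  · linarith [gerber_le_log_two (u + s) (v + t)]
  rcases hvt.eq_or_lt with h | hy1
  · linarith [gerber_le_log_two (u + s) (v + t)]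
  have := gerber_le_add_of_mul ⟨hx0, hx1⟩ ⟨hy0, hy1⟩
    (a := u / (u + s)) (b := v / (v + t))
    ⟨by positivity, (div_le_one hx0).2 (by linarith)⟩
    ⟨by positivity, (div_le_one hy0).2 (by linarith)⟩
  rwa [div_mul_cancel₀ _ hx0.ne', div_mul_cancel₀ _ hy0.ne', sub_mul, sub_mul,
    div_mul_cancel₀ _ hx0.ne', div_mul_cancel₀ _ hy0.ne', one_mul, one_mul,
    add_sub_cancel_left, add_sub_cancel_left] at this

/-- The counterpart of `gerber_add_le` when both sums exceed one bit. -/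
lemma gerber_add_sub_le {u v s t : ℝ} (hu : u ≤ log 2) (hv : v ≤ log 2) (hs : s ≤ log 2)
    (ht : t ≤ log 2) (hus : log 2 ≤ u + s) (hvt : log 2 ≤ v + t) :
    gerber (u + s - log 2) (v + t - log 2) + log 2 ≤ gerber u v + gerber s t := by
  have l1 := le_gerber_left hu v
  have l2 := le_gerber_right u hv
  have l3 := le_gerber_left hs t
  have l4 := le_gerber_right s ht
  have l5 := gerber_le_log_two (u + s - log 2) (v + t - log 2)
  rcases hus.eq_or_lt with h | hx0
  · rw [← h, sub_self, gerber_of_nonpos le_rfl ⟨by linarith, by linarith⟩]; linarith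
  rcases hvt.eq_or_lt with h | hy0
  · rw [← h, sub_self, gerber_comm, gerber_of_nonpos le_rfl ⟨by linarith, by linarith⟩]; linarith
  have hx2 : 0 ≤ 2 * log 2 - (u + s) := by linarith
  have hy2 : 0 ≤ 2 * log 2 - (v + t) := by linarith
  rcases hx2.eq_or_lt with h | hx1
  · linarith
  rcases hy2.eq_or_lt with h | hy1
  · linarith
  have := gerber_corner_le_add_of_mul (u := 2 * log 2 - (u + s)) (v := 2 * log 2 - (v + t))
    ⟨hx1, by linarith⟩ ⟨hy1, by linarith⟩
    (a := (log 2 - u) / (2 * log 2 - (u + s))) (b := (log 2 - v) / (2 * log 2 - (v + t)))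
    ⟨div_nonneg (by linarith) hx2, (div_le_one hx1).2 (by linarith)⟩
    ⟨div_nonneg (by linarith) hy2, (div_le_one hy1).2 (by linarith)⟩
  rw [sub_mul, sub_mul, div_mul_cancel₀ _ hx1.ne', div_mul_cancel₀ _ hy1.ne'] at this
  convert this using 3 <;> ring

/-! ### The closed form for groups of order `2 ^ n` -/

/-- The minimal entropy of a sum on a group of order `2 ^ n`, in closed form: all summands but one
are `0` or `log 2` as soon as `x` and `y` lie in a common interval `[k log 2, (k + 1) log 2]`, and
otherwise the sum is `max x y`. -/
noncomputable def iterGerber (n : ℕ) (x y : ℝ) : ℝ :=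
  ∑ k ∈ Finset.range n, gerber (x - k * log 2) (y - k * log 2)

lemma iterGerber_comm (n : ℕ) (x y : ℝ) : iterGerber n x y = iterGerber n y x :=
  Finset.sum_congr rfl fun _ _ => gerber_comm _ _

lemma iterGerber_nonneg (n : ℕ) (x y : ℝ) : 0 ≤ iterGerber n x y :=
  Finset.sum_nonneg fun _ _ => gerber_nonneg _ _

lemma iterGerber_mono_left (n : ℕ) (y : ℝ) : Monotone fun x => iterGerber n x y :=
  fun _ _ h => Finset.sum_le_sum fun _ _ => gerber_mono_left _ (sub_le_sub_right h _)

@[simp] lemma iterGerber_zero (x y : ℝ) : iterGerber 0 x y = 0 := rfl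

lemma iterGerber_succ (n : ℕ) (x y : ℝ) :
    iterGerber (n + 1) x y = gerber x y + iterGerber n (x - log 2) (y - log 2) := by
  rw [iterGerber, Finset.sum_range_succ', add_comm]
  simp only [Nat.cast_zero, zero_mul, sub_zero, iterGerber]
  congr 1
  refine Finset.sum_congr rfl fun k _ => ?_
  push_cast
  congr 1 <;> ring

lemma iterGerber_of_nonpos_nonpos (n : ℕ) {x y : ℝ} (hx : x ≤ 0) (hy : y ≤ 0) :
    iterGerber n x y = 0 := by
  refine Finset.sum_eq_zero fun k _ => ?_
  have : 0 ≤ k * log 2 := mul_nonneg k.cast_nonneg log_two_pos.le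
  exact gerber_of_nonpos_nonpos (by linarith) (by linarith)

lemma iterGerber_of_nonpos {n : ℕ} {x y : ℝ} (hx : x ≤ 0) (hy : y ∈ Icc 0 (n * log 2)) :
    iterGerber n x y = y := by
  induction n generalizing x y with
  | zero => simpa using (le_antisymm (by simpa using hy.2) hy.1).symm
  | succ n ih =>
    have hL := log_two_pos
    rw [iterGerber_succ]
    rcases le_total y (log 2) with h | h
    · rw [gerber_of_nonpos hx ⟨hy.1, h⟩,
        iterGerber_of_nonpos_nonpos n (by linarith) (by linarith), add_zero]
    · have := hy.2
      push_cast at this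
      rw [gerber_comm, gerber_of_log_two_le h, ih (by linarith) ⟨by linarith, by linarith⟩]
      ring

lemma le_iterGerber_right {n : ℕ} (x : ℝ) {y : ℝ} (hy : y ≤ n * log 2) :
    y ≤ iterGerber n x y := by
  rcases le_total 0 y with h | h
  · calc y = iterGerber n (min x 0) y := (iterGerber_of_nonpos (min_le_right _ _) ⟨h, hy⟩).symm
      _ ≤ _ := iterGerber_mono_left n y (min_le_left _ _)
  · exact h.trans (iterGerber_nonneg n x y)

lemma le_iterGerber_left {n : ℕ} {x : ℝ} (hx : x ≤ n * log 2) (y : ℝ) :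
    x ≤ iterGerber n x y := by
  rw [iterGerber_comm]; exact le_iterGerber_right y hx

lemma iterGerber_of_le_log_two (n : ℕ) {x y : ℝ} (hx : x ≤ log 2) (hy : y ≤ log 2) :
    iterGerber (n + 1) x y = gerber x y := by
  rw [iterGerber_succ, iterGerber_of_nonpos_nonpos n (by linarith) (by linarith), add_zero]

lemma iterGerber_of_log_two_le {n : ℕ} {x y : ℝ} (hx : log 2 ≤ x) :
    iterGerber (n + 1) x y = log 2 + iterGerber n (x - log 2) (y - log 2) := by
  rw [iterGerber_succ, gerber_of_log_two_le hx]

lemma iterGerber_of_le_of_le {n : ℕ} {x y : ℝ} (hx : x ≤ log 2) (hy : log 2 ≤ y)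
    (hy' : y ≤ (n + 1 : ℕ) * log 2) : iterGerber (n + 1) x y = y := by
  push_cast at hy'
  rw [iterGerber_comm, iterGerber_of_log_two_le hy, iterGerber_comm,
    iterGerber_of_nonpos (by linarith) ⟨by linarith, by linarith⟩]
  ring

/-- Two convex functions on adjacent intervals glue to a convex function if there is a supporting
line at the junction. -/
lemma convexOn_glue {f : ℝ → ℝ} {a b c m : ℝ} (h1 : ConvexOn ℝ (Icc a c) f)
    (h2 : ConvexOn ℝ (Icc c b) f) (hm : ∀ x ∈ Icc a b, f c + m * (x - c) ≤ f x) :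
    ConvexOn ℝ (Icc a b) f := by
  refine LinearOrder.convexOn_of_lt (convex_Icc a b) ?_
  intro x hx y hy hxy p q hp hq hpq
  simp only [smul_eq_mul]
  rcases le_total c x with hcx | hcx
  · exact h2.2 ⟨hcx, hx.2⟩ ⟨hcx.trans hxy.le, hy.2⟩ hp.le hq.le hpq
  rcases le_total y c with hyc | hyc
  · exact h1.2 ⟨hx.1, hcx⟩ ⟨hy.1, hyc⟩ hp.le hq.le hpq
  obtain rfl : p = 1 - q := by linarith
  have hmx := hm x hx
  have hmy := hm y hy
  -- On either side of `c` use the chord to `c`, whose value lies below the long chord.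
  rcases le_total ((1 - q) * x + q * y) c with hz | hz
  · rcases hcx.eq_or_lt with rfl | hcx
    · exact h2.2 ⟨le_rfl, hx.2⟩ ⟨hyc, hy.2⟩ hp.le hq.le hpq
    have hcx' : 0 < c - x := sub_pos.2 hcx
    set r := q * (y - x) / (c - x) with hr
    have hr0 : 0 ≤ r := div_nonneg (mul_nonneg hq.le (by linarith)) hcx'.le
    have hr1 : r ≤ 1 := by rw [hr, div_le_one hcx']; linarith
    have hrc : r * (c - x) = q * (y - x) := by rw [hr]; field_simp
    have e := h1.2 (x := x) (y := c) ⟨hx.1, hcx.le⟩ ⟨hx.1.trans hcx.le, le_rfl⟩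
      (sub_nonneg.2 hr1) hr0 (by ring)
    simp only [smul_eq_mul] at e
    rw [show (1 - r) * x + r * c = (1 - q) * x + q * y by linarith] at e
    have hrq : q ≤ r := by
      rw [hr, le_div_iff₀ hcx']; nlinarith
    have p1 := mul_le_mul_of_nonneg_left hmx (sub_nonneg.2 hrq)
    have p2 := mul_le_mul_of_nonneg_left hmy hq.le
    linear_combination e + p1 + p2 + m * hrc
  · rcases hyc.eq_or_lt with rfl | hyc
    · exact h1.2 ⟨hx.1, hcx⟩ ⟨hy.1, le_rfl⟩ hp.le hq.le hpq
    have hyc' : 0 < y - c := sub_pos.2 hyc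
    set r := (1 - q) * (y - x) / (y - c) with hr
    have hr0 : 0 ≤ r := div_nonneg (mul_nonneg hp.le (by linarith)) hyc'.le
    have hr1 : r ≤ 1 := by rw [hr, div_le_one hyc']; linarith
    have hrc : r * (y - c) = (1 - q) * (y - x) := by rw [hr]; field_simp
    have e := h2.2 (x := c) (y := y) ⟨le_rfl, hyc.le.trans hy.2⟩ ⟨hyc.le, hy.2⟩
      hr0 (sub_nonneg.2 hr1) (by ring)
    simp only [smul_eq_mul] at e
    rw [show r * c + (1 - r) * y = (1 - q) * x + q * y by linarith] at e
    have hrq : 1 - q ≤ r := by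
      rw [hr, le_div_iff₀ hyc']; nlinarith
    have p1 := mul_le_mul_of_nonneg_left hmy (sub_nonneg.2 hrq)
    have p2 := mul_le_mul_of_nonneg_left hmx hp.le
    linear_combination e + p1 + p2 - m * hrc

lemma convexOn_iterGerber_left {n : ℕ} {y : ℝ} (hy : y ∈ Icc 0 (n * log 2)) :
    ConvexOn ℝ (Icc 0 (n * log 2)) fun x => iterGerber n x y := by
  induction n generalizing y with
  | zero => exact convexOn_const 0 (convex_Icc _ _)
  | succ n ih =>
    have hL := log_two_pos
    rcases le_total y (log 2) with h | h
    · refine convexOn_glue (c := log 2) (m := 1) ?_ ?_ ?_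
      · refine (convexOn_gerber_left ⟨hy.1, h⟩).congr fun x hx => ?_
        exact (iterGerber_of_le_log_two n hx.2 h).symm
      · refine (convexOn_id (convex_Icc _ _)).congr fun x hx => ?_
        simp only [id]
        rw [iterGerber_comm, iterGerber_of_le_of_le h hx.1 hx.2]
      · intro x hx
        rw [iterGerber_of_le_log_two n le_rfl h, gerber_of_log_two_le le_rfl]
        linarith [le_iterGerber_left hx.2 y]
    · refine convexOn_glue (c := log 2) (m := 0) ?_ ?_ ?_
      · refine (convexOn_const y (convex_Icc _ _)).congr fun x hx => ?_
        exact (iterGerber_of_le_of_le hx.2 h hy.2).symm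
      · have h2 := hy.2
        push_cast at h2
        have hc := ih (y := y - log 2) ⟨by linarith, by linarith⟩
        have hc := ((hc.translate_left (-log 2)).add_const (log 2)).subset
          (s := Icc (log 2) ((n + 1 : ℕ) * log 2)) (fun x hx => ?_) (convex_Icc _ _)
        · refine hc.congr fun x hx => ?_
          rw [iterGerber_of_log_two_le hx.1]
          simp [sub_eq_add_neg, add_comm]
        · have := hx.2
          push_cast at this
          simp only [mem_preimage, mem_Icc]
          constructor <;> linarith [hx.1]
      · intro x hx
        rw [iterGerber_of_le_of_le le_rfl h hy.2]
        linarith [le_iterGerber_right x hy.2]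

/-- Superadditivity under an extension by a group of order two: a chain rule splitting
`x = x₁ + s`, `y = y₁ + t` never does better than the closed form. -/
lemma iterGerber_add_le {n : ℕ} {x y s t : ℝ} (hx : x ∈ Icc 0 (n * log 2))
    (hy : y ∈ Icc 0 (n * log 2)) (hs : s ∈ Icc 0 (log 2)) (ht : t ∈ Icc 0 (log 2)) :
    iterGerber (n + 1) (x + s) (y + t) ≤ iterGerber n x y + gerber s t := by
  have hL := log_two_pos
  induction n generalizing x y with
  | zero =>
    have hx0 : x = 0 := le_antisymm (by simpa using hx.2) hx.1
    have hy0 : y = 0 := le_antisymm (by simpa using hy.2) hy.1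
    simp [iterGerber_succ, hx0, hy0]
  | succ n ih =>
    have hs' := le_gerber_left hs.2 t
    have ht' := le_gerber_right s ht.2
    -- The case of a small and a large argument.
    have mixed : ∀ x ∈ Icc 0 (log 2), ∀ y ∈ Icc (log 2) ((n + 1 : ℕ) * log 2), ∀ s ∈ Icc 0 (log 2),
        ∀ t ∈ Icc 0 (log 2), (∀ {x' y' : ℝ}, x' ∈ Icc 0 (n * log 2) → y' ∈ Icc 0 (n * log 2) →
          iterGerber (n + 1) (x' + s) (y' + t) ≤ iterGerber n x' y' + gerber s t) →
        iterGerber (n + 2) (x + s) (y + t) ≤ iterGerber (n + 1) x y + gerber s t := by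
      intro x hx y hy s hs t ht ih
      have h2 := hy.2
      push_cast at h2
      rw [iterGerber_of_le_of_le hx.2 hy.1 hy.2]
      have ht' := le_gerber_right s ht.2
      rcases le_total (x + s) (log 2) with h | h
      · rw [iterGerber_of_le_of_le h (by linarith [hy.1, ht.1])
          (by push_cast; linarith [ht.2])]
        linarith
      · rw [iterGerber_of_log_two_le h]
        have e := ih (x' := 0) (y' := y - log 2)
          ⟨le_rfl, by have := log_two_pos; positivity⟩ ⟨by linarith [hy.1], by linarith⟩
        rw [iterGerber_of_nonpos le_rfl ⟨by linarith [hy.1], by linarith⟩] at e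
        have e2 := iterGerber_mono_left (n + 1) (y - log 2 + t)
          (show x + s - log 2 ≤ 0 + s by linarith [hx.2])
        simp only at e2
        rw [show y + t - log 2 = y - log 2 + t by ring]
        linarith
    rcases le_total x (log 2) with h1 | h1 <;> rcases le_total y (log 2) with h2 | h2
    · rw [iterGerber_of_le_log_two n h1 h2]
      have hx' := le_gerber_left h1 y
      have hy' := le_gerber_right x h2
      rcases le_total (x + s) (log 2) with h3 | h3 <;> rcases le_total (y + t) (log 2) with h4 | h4
      · rw [iterGerber_of_le_log_two _ h3 h4]
        exact gerber_add_le hx.1 hy.1 hs.1 ht.1 h3 h4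
      · rw [iterGerber_of_le_of_le h3 h4
          (by push_cast; nlinarith [ht.2, (n.cast_nonneg : (0 : ℝ) ≤ n)])]
        linarith
      · rw [iterGerber_comm, iterGerber_of_le_of_le h4 h3
          (by push_cast; nlinarith [hs.2, (n.cast_nonneg : (0 : ℝ) ≤ n)])]
        linarith
      · rw [iterGerber_of_log_two_le h3, iterGerber_of_le_log_two n (by linarith [hs.2])
          (by linarith [ht.2])]
        linarith [gerber_add_sub_le h1 h2 hs.2 ht.2 h3 h4]
    · exact mixed x ⟨hx.1, h1⟩ y ⟨h2, hy.2⟩ s hs t ht ih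
    · rw [iterGerber_comm, iterGerber_comm (n + 1), gerber_comm]
      refine mixed y ⟨hy.1, h2⟩ x ⟨h1, hx.2⟩ t ht s hs fun {x' y'} hx' hy' => ?_
      rw [iterGerber_comm, iterGerber_comm n, gerber_comm]
      exact ih hy' hx'
    · have h3 := hx.2
      have h4 := hy.2
      push_cast at h3 h4
      rw [iterGerber_of_log_two_le h1, iterGerber_of_log_two_le (by linarith [hs.1])]
      have := ih (x := x - log 2) (y := y - log 2) ⟨by linarith, by linarith⟩
        ⟨by linarith, by linarith⟩
      rw [show x + s - log 2 = x - log 2 + s by ring, show y + t - log 2 = y - log 2 + t by ring]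
      linarith

lemma iterGerber_succ_of_le {n : ℕ} {x y : ℝ} (hx : x ≤ n * log 2) (hy : y ≤ n * log 2) :
    iterGerber (n + 1) x y = iterGerber n x y := by
  rw [iterGerber, Finset.sum_range_succ, gerber_of_nonpos_nonpos (by linarith) (by linarith),
    add_zero, iterGerber]

lemma iterGerber_succ_of_ge {n : ℕ} {x : ℝ} (y : ℝ) (hx : n * log 2 ≤ x) :
    iterGerber (n + 1) x y = n * log 2 + gerber (x - n * log 2) (y - n * log 2) := by
  rw [iterGerber, Finset.sum_range_succ]
  congr 1
  rw [Finset.sum_eq_card_nsmul (b := log 2), Finset.card_range, nsmul_eq_mul]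
  intro k hk
  have hk : (k : ℝ) + 1 ≤ n := by exact_mod_cast Finset.mem_range.1 hk
  exact gerber_of_log_two_le (by nlinarith [log_two_pos]) _

lemma iterGerber_succ_of_ge_of_le {n : ℕ} {x y : ℝ} (hx : n * log 2 ≤ x)
    (hx' : x ≤ (n + 1 : ℕ) * log 2) (hy : y ≤ n * log 2) : iterGerber (n + 1) x y = x := by
  push_cast at hx'
  rw [iterGerber_succ_of_ge y hx, gerber_comm,
    gerber_of_nonpos (by linarith) ⟨by linarith, by linarith⟩]
  ring

/-! ### Entropies of sums in groups of order `2 ^ n` -/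

section Entropy

variable {ι : Type*} [Fintype ι]

lemma shannonEntropy_nonneg {p : ι → ℝ} (hp : p ∈ stdSimplex ℝ ι) : 0 ≤ shannonEntropy p :=
  Finset.sum_nonneg fun i _ => negMulLog_nonneg (hp.1 i) <| by
    rw [← hp.2]; exact Finset.single_le_sum (fun j _ => hp.1 j) (Finset.mem_univ i)

lemma nonempty_of_mem_stdSimplex {p : ι → ℝ} (hp : p ∈ stdSimplex ℝ ι) : Nonempty ι := by
  by_contra h
  rw [not_nonempty_iff] at h
  simpa using hp.2

lemma shannonEntropy_le_log_card {p : ι → ℝ} (hp : p ∈ stdSimplex ℝ ι) :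
    shannonEntropy p ≤ log (Fintype.card ι) := by
  have := nonempty_of_mem_stdSimplex hp
  have hN : (0 : ℝ) < Fintype.card ι := by exact_mod_cast Fintype.card_pos
  have h := concaveOn_negMulLog.le_map_sum (t := Finset.univ) (p := p)
    (w := fun _ => (Fintype.card ι : ℝ)⁻¹) (fun _ _ => by positivity)
    (by simp [hN.ne']) (fun i _ => hp.1 i)
  simp only [smul_eq_mul, ← Finset.mul_sum, hp.2, mul_one] at h
  have e : negMulLog (Fintype.card ι : ℝ)⁻¹ = (Fintype.card ι : ℝ)⁻¹ * log (Fintype.card ι) := by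
    simp [negMulLog, log_inv]
  rw [e] at h
  exact le_of_mul_le_mul_left h (inv_pos.2 hN)

lemma sum_negMulLog_mul (m : ℝ) {p : ι → ℝ} (hp : p ∈ stdSimplex ℝ ι) :
    ∑ i, negMulLog (m * p i) = negMulLog m + m * shannonEntropy p := by
  simp_rw [negMulLog_mul, Finset.sum_add_distrib, ← Finset.sum_mul, ← Finset.mul_sum, hp.2, one_mul,
    shannonEntropy]

/-- Concavity of entropy, for a mixture of total mass `a + b`. -/
lemma le_sum_negMulLog_add {a b : ℝ} (ha : 0 ≤ a) (hb : 0 ≤ b) {p q : ι → ℝ}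
    (hp : p ∈ stdSimplex ℝ ι) (hq : q ∈ stdSimplex ℝ ι) :
    negMulLog (a + b) + a * shannonEntropy p + b * shannonEntropy q
      ≤ ∑ i, negMulLog (a * p i + b * q i) := by
  rcases (add_nonneg ha hb).eq_or_lt with h | h
  · obtain rfl : a = 0 := by linarith
    obtain rfl : b = 0 := by linarith
    simp
  have hab : a / (a + b) + b / (a + b) = 1 := by rw [← add_div, div_self h.ne']
  have ha' : 0 ≤ a / (a + b) := by positivity
  have hb' : 0 ≤ b / (a + b) := by positivity
  have hmix : (a / (a + b)) • p + (b / (a + b)) • q ∈ stdSimplex ℝ ι :=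
    convex_stdSimplex ℝ ι hp hq ha' hb' hab
  have e : ∀ i, a * p i + b * q i = (a + b) * ((a / (a + b)) • p + (b / (a + b)) • q) i := by
    intro i
    simp only [Pi.add_apply, Pi.smul_apply, smul_eq_mul]
    field_simp
  simp_rw [e]
  rw [sum_negMulLog_mul _ hmix]
  have hc : a / (a + b) * shannonEntropy p + b / (a + b) * shannonEntropy q
      ≤ shannonEntropy ((a / (a + b)) • p + (b / (a + b)) • q) := by
    simp only [shannonEntropy, Finset.mul_sum, ← Finset.sum_add_distrib]
    exact Finset.sum_le_sum fun i _ =>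
      concaveOn_negMulLog.2 (x := p i) (y := q i) (hp.1 i) (hq.1 i) ha' hb' hab
  have := mul_le_mul_of_nonneg_left hc h.le
  have e2 : (a + b) * (a / (a + b) * shannonEntropy p + b / (a + b) * shannonEntropy q)
      = a * shannonEntropy p + b * shannonEntropy q := by field_simp
  linarith

lemma exists_eq_sum_mul [Nonempty ι] {p : ι → ℝ} (hp : ∀ i, 0 ≤ p i) :
    ∃ P ∈ stdSimplex ℝ ι, ∀ i, p i = (∑ j, p j) * P i := by
  classical
  rcases (Finset.sum_nonneg fun i _ => hp i : 0 ≤ ∑ j, p j).eq_or_lt with h | h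
  · refine ⟨Pi.single (Classical.arbitrary ι) 1, single_mem_stdSimplex ℝ _, fun i => ?_⟩
    rw [← h, zero_mul]
    exact (Finset.sum_eq_zero_iff_of_nonneg fun i _ => hp i).1 h.symm i (Finset.mem_univ i)
  · refine ⟨fun i => p i / ∑ j, p j, ⟨fun i => div_nonneg (hp i) h.le, ?_⟩, fun i => ?_⟩
    · rw [← Finset.sum_div, div_self h.ne']
    · field_simp

/-- The uniform law. -/
noncomputable def uniformLaw (ι : Type*) [Fintype ι] : ι → ℝ := fun _ => (Fintype.card ι : ℝ)⁻¹

lemma uniformLaw_mem [Nonempty ι] : uniformLaw ι ∈ stdSimplex ℝ ι := by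
  refine ⟨fun _ => by unfold uniformLaw; positivity, ?_⟩
  simp [uniformLaw]

lemma shannonEntropy_uniformLaw [Nonempty ι] :
    shannonEntropy (uniformLaw ι) = log (Fintype.card ι) := by
  simp [shannonEntropy, uniformLaw, negMulLog, log_inv]

end Entropy

section Coset

variable {G : Type*} [AddCommGroup G] {H : AddSubgroup G} {t : G}

lemma add_self_mem_of_not_mem (ht : t ∉ H) (hH : ∀ g, g ∉ H → g - t ∈ H) : t + t ∈ H := by
  by_contra h
  exact ht (by simpa using hH _ h)

/-- For `t ∉ H` and `H` of index two: the law `p` puts mass `m₀` on the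
subgroup `H` and `m₁` on the coset `H + t`, with conditional laws
`P₀` and (after translation by `t`) `P₁`. -/
def IsCosetMixture (H : AddSubgroup G) (t : G) (p : G → ℝ) (m₀ : ℝ) (P₀ : H → ℝ) (m₁ : ℝ)
    (P₁ : H → ℝ) : Prop :=
  (∀ h : H, p h = m₀ * P₀ h) ∧ ∀ h : H, p (h + t) = m₁ * P₁ h

lemma exists_isCosetMixture (ht : t ∉ H) (hH : ∀ g, g ∉ H → g - t ∈ H) (m₀ m₁ : ℝ)
    (P₀ P₁ : H → ℝ) : ∃ p, IsCosetMixture H t p m₀ P₀ m₁ P₁ := by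
  classical
  refine ⟨fun g => if h : g ∈ H then m₀ * P₀ ⟨g, h⟩ else m₁ * P₁ ⟨g - t, hH g h⟩,
    fun h => by simp, fun h => ?_⟩
  have : (h : G) + t ∉ H := fun hmem => ht <| by simpa using H.sub_mem hmem h.2
  simp [this]

end Coset

section Sum

variable {G : Type*} [AddCommGroup G] [Fintype G]

lemma lawOfSum_comm (p q : G → ℝ) : lawOfSum p q = lawOfSum q p := by
  funext g
  unfold lawOfSum
  refine Fintype.sum_equiv (Equiv.subLeft g) _ _ fun a => ?_
  simp [mul_comm]

lemma sum_sub_left (q : G → ℝ) (g : G) : ∑ a, q (g - a) = ∑ a, q a :=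
  (Equiv.subLeft g).sum_comp q

lemma sum_sub_right (q : G → ℝ) (a : G) : ∑ g, q (g - a) = ∑ g, q g :=
  (Equiv.subRight a).sum_comp q

lemma lawOfSum_mem {p q : G → ℝ} (hp : p ∈ stdSimplex ℝ G) (hq : q ∈ stdSimplex ℝ G) :
    lawOfSum p q ∈ stdSimplex ℝ G := by
  refine ⟨fun g => Finset.sum_nonneg fun a _ => mul_nonneg (hp.1 a) (hq.1 _), ?_⟩
  unfold lawOfSum
  rw [Finset.sum_comm]
  simp_rw [← Finset.mul_sum, sum_sub_right, hq.2, mul_one, hp.2]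

lemma lawOfSum_uniformLaw_left {q : G → ℝ} (hq : q ∈ stdSimplex ℝ G) :
    lawOfSum (uniformLaw G) q = uniformLaw G := by
  funext g
  simp only [lawOfSum, uniformLaw]
  rw [← Finset.mul_sum, sum_sub_left, hq.2, mul_one]

lemma lawOfSum_mul (m n : ℝ) (p q : G → ℝ) (g : G) :
    lawOfSum (fun a => m * p a) (fun a => n * q a) g = m * n * lawOfSum p q g := by
  simp only [lawOfSum, Finset.mul_sum]
  exact Finset.sum_congr rfl fun a _ => by ring

variable {H : AddSubgroup G} [Fintype H] {t : G}

lemma sum_eq_sum_coset (ht : t ∉ H) (hH : ∀ g, g ∉ H → g - t ∈ H) (φ : G → ℝ) :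
    ∑ g, φ g = ∑ h : H, φ h + ∑ h : H, φ (h + t) := by
  rw [← Fintype.sum_sumElim]
  have hnot : ∀ h : H, (h : G) + t ∉ H := fun h hmem => ht <| by
    simpa using H.sub_mem hmem h.2
  refine (Function.Bijective.sum_comp
    (e := Sum.elim (fun h : H => (h : G)) fun h : H => (h : G) + t)
    ⟨?_, ?_⟩ φ).symm.trans (Finset.sum_congr rfl fun x _ => by cases x <;> rfl)
  · rintro (a | a) (b | b) h
    · exact congrArg _ (Subtype.ext h)
    · exact ((hnot b) ((show (a : G) = b + t from h) ▸ a.2)).elim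
    · exact ((hnot a) ((show (a : G) + t = b from h).symm ▸ b.2)).elim
    · exact congrArg _ (Subtype.ext (add_right_cancel h))
  · intro g
    by_cases hg : g ∈ H
    · exact ⟨Sum.inl ⟨g, hg⟩, rfl⟩
    · exact ⟨Sum.inr ⟨g - t, hH g hg⟩, by simp⟩

lemma exists_cosetMixture_eq (ht : t ∉ H) (hH : ∀ g, g ∉ H → g - t ∈ H) {p : G → ℝ}
    (hp : p ∈ stdSimplex ℝ G) : ∃ m₀ m₁, 0 ≤ m₀ ∧ 0 ≤ m₁ ∧ m₀ + m₁ = 1 ∧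
      ∃ P₀ ∈ stdSimplex ℝ H, ∃ P₁ ∈ stdSimplex ℝ H, IsCosetMixture H t p m₀ P₀ m₁ P₁ := by
  obtain ⟨P₀, hP₀, e₀⟩ := exists_eq_sum_mul (p := fun h : H => p h) fun h => hp.1 _
  obtain ⟨P₁, hP₁, e₁⟩ := exists_eq_sum_mul (p := fun h : H => p (h + t)) fun h => hp.1 _
  refine ⟨_, _, Finset.sum_nonneg fun h _ => hp.1 _, Finset.sum_nonneg fun h _ => hp.1 _, ?_,
    P₀, hP₀, P₁, hP₁, e₀, e₁⟩
  rw [← sum_eq_sum_coset ht hH p, hp.2]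

namespace IsCosetMixture

variable {p q : G → ℝ} {m₀ m₁ n₀ n₁ : ℝ} {P₀ P₁ Q₀ Q₁ : H → ℝ}

lemma mem_stdSimplex (hpm : IsCosetMixture H t p m₀ P₀ m₁ P₁)
    (ht : t ∉ H) (hH : ∀ g, g ∉ H → g - t ∈ H)
    (hm₀ : 0 ≤ m₀) (hm₁ : 0 ≤ m₁) (hm : m₀ + m₁ = 1) (hP₀ : P₀ ∈ stdSimplex ℝ H)
    (hP₁ : P₁ ∈ stdSimplex ℝ H) : p ∈ stdSimplex ℝ G := by
  constructor
  · intro g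
    by_cases hg : g ∈ H
    · exact (hpm.1 ⟨g, hg⟩).symm ▸ mul_nonneg hm₀ (hP₀.1 _)
    · have := hpm.2 ⟨g - t, hH g hg⟩
      rw [sub_add_cancel] at this
      exact this.symm ▸ mul_nonneg hm₁ (hP₁.1 _)
  · rw [sum_eq_sum_coset ht hH]
    simp_rw [hpm.1, hpm.2, ← Finset.mul_sum, hP₀.2, hP₁.2, mul_one, hm]

lemma shannonEntropy_eq (hpm : IsCosetMixture H t p m₀ P₀ m₁ P₁)
    (ht : t ∉ H) (hH : ∀ g, g ∉ H → g - t ∈ H) (hm : m₀ + m₁ = 1)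
    (hP₀ : P₀ ∈ stdSimplex ℝ H) (hP₁ : P₁ ∈ stdSimplex ℝ H) :
    shannonEntropy p = (m₀ * shannonEntropy P₀ + m₁ * shannonEntropy P₁) + binEntropy m₁ := by
  rw [shannonEntropy, sum_eq_sum_coset ht hH]
  simp_rw [hpm.1, hpm.2]
  rw [sum_negMulLog_mul _ hP₀, sum_negMulLog_mul _ hP₁,
    binEntropy_eq_negMulLog_add_negMulLog_one_sub, show 1 - m₁ = m₀ by linarith]
  ring

lemma lawOfSum_coe (hpm : IsCosetMixture H t p m₀ P₀ m₁ P₁) (hqm : IsCosetMixture H t q n₀ Q₀ n₁ Q₁)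
    (ht : t ∉ H) (hH : ∀ g, g ∉ H → g - t ∈ H) (h : H) :
    lawOfSum p q h = m₀ * n₀ * lawOfSum P₀ Q₀ h
      + m₁ * n₁ * lawOfSum P₁ Q₁ (h - ⟨t + t, add_self_mem_of_not_mem ht hH⟩) := by
  rw [lawOfSum, sum_eq_sum_coset ht hH, ← lawOfSum_mul, ← lawOfSum_mul]
  congr 1 <;> refine Finset.sum_congr rfl fun a _ => ?_
  · rw [hpm.1, show q (h - a) = n₀ * Q₀ (h - a) from hqm.1 (h - a)]
  · have e : (h : G) - (a + t) =
        ((h - ⟨t + t, add_self_mem_of_not_mem ht hH⟩ - a : H) : G) + t := by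
      push_cast; abel
    rw [hpm.2, e, hqm.2]

lemma lawOfSum_add (hpm : IsCosetMixture H t p m₀ P₀ m₁ P₁) (hqm : IsCosetMixture H t q n₀ Q₀ n₁ Q₁)
    (ht : t ∉ H) (hH : ∀ g, g ∉ H → g - t ∈ H) (h : H) :
    lawOfSum p q (h + t) = m₀ * n₁ * lawOfSum P₀ Q₁ h + m₁ * n₀ * lawOfSum P₁ Q₀ h := by
  rw [lawOfSum, sum_eq_sum_coset ht hH, ← lawOfSum_mul, ← lawOfSum_mul]
  congr 1 <;> refine Finset.sum_congr rfl fun a _ => ?_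
  · have e : (h : G) + t - a = ((h - a : H) : G) + t := by push_cast; abel
    rw [hpm.1, e, hqm.2]
  · have e : (h : G) + t - (a + t) = ((h - a : H) : G) := by push_cast; abel
    rw [hpm.2, e, hqm.1]

end IsCosetMixture

lemma gerber_binEntropy {a b : ℝ} (ha : a ∈ Icc (0 : ℝ) 1) (hb : b ∈ Icc (0 : ℝ) 1) :
    gerber (binEntropy a) (binEntropy b) = binEntropy ((1 - a) * b + a * (1 - b)) := by
  have key : ∀ a ∈ Icc (0 : ℝ) 1, bias (binEntropy a) = |1 - 2 * a| := fun a ha => by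
    rw [← biasEntropy_one_sub_two_mul, ← biasEntropy_abs, bias_biasEntropy]
    exact ⟨abs_nonneg _, abs_le.2 ⟨by linarith [ha.2], by linarith [ha.1]⟩⟩
  rw [gerber, key a ha, key b hb, ← abs_mul, biasEntropy_abs, ← biasEntropy_one_sub_two_mul]
  congr 1; ring

/-- The chain rule and concavity bound the entropy of the sum from below by the entropies of the
sums of the conditional laws. -/
lemma le_shannonEntropy_lawOfSum {p q : G → ℝ} {m₀ m₁ n₀ n₁ : ℝ} {P₀ P₁ Q₀ Q₁ : H → ℝ}
    (hpm : IsCosetMixture H t p m₀ P₀ m₁ P₁) (hqm : IsCosetMixture H t q n₀ Q₀ n₁ Q₁)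
    (ht : t ∉ H) (hH : ∀ g, g ∉ H → g - t ∈ H)
    (hm₀ : 0 ≤ m₀) (hm₁ : 0 ≤ m₁) (hm : m₀ + m₁ = 1) (hn₀ : 0 ≤ n₀) (hn₁ : 0 ≤ n₁)
    (hn : n₀ + n₁ = 1) (hP₀ : P₀ ∈ stdSimplex ℝ H) (hP₁ : P₁ ∈ stdSimplex ℝ H)
    (hQ₀ : Q₀ ∈ stdSimplex ℝ H) (hQ₁ : Q₁ ∈ stdSimplex ℝ H) :
    m₀ * (n₀ * shannonEntropy (lawOfSum P₀ Q₀) + n₁ * shannonEntropy (lawOfSum P₀ Q₁))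
      + m₁ * (n₀ * shannonEntropy (lawOfSum P₁ Q₀) + n₁ * shannonEntropy (lawOfSum P₁ Q₁))
      + gerber (binEntropy m₁) (binEntropy n₁) ≤ shannonEntropy (lawOfSum p q) := by
  obtain rfl : m₀ = 1 - m₁ := by linarith
  obtain rfl : n₀ = 1 - n₁ := by linarith
  rw [gerber_binEntropy ⟨hm₁, by linarith⟩ ⟨hn₁, by linarith⟩,
    show shannonEntropy (lawOfSum p q) = ∑ g, negMulLog (lawOfSum p q g) from rfl,
    sum_eq_sum_coset ht hH]
  simp_rw [hpm.lawOfSum_coe hqm ht hH, hpm.lawOfSum_add hqm ht hH]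
  set s : H := ⟨t + t, add_self_mem_of_not_mem ht hH⟩
  have hshift : (fun h => lawOfSum P₁ Q₁ (h - s)) ∈ stdSimplex ℝ H :=
    ⟨fun h => (lawOfSum_mem hP₁ hQ₁).1 _, by
      rw [sum_sub_right]; exact (lawOfSum_mem hP₁ hQ₁).2⟩
  have eshift : shannonEntropy (fun h => lawOfSum P₁ Q₁ (h - s))
      = shannonEntropy (lawOfSum P₁ Q₁) :=
    sum_sub_right (fun h => negMulLog (lawOfSum P₁ Q₁ h)) s
  have h0 := le_sum_negMulLog_add (mul_nonneg hm₀ hn₀) (mul_nonneg hm₁ hn₁)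
    (lawOfSum_mem hP₀ hQ₀) hshift
  have h1 := le_sum_negMulLog_add (mul_nonneg hm₀ hn₁) (mul_nonneg hm₁ hn₀)
    (lawOfSum_mem hP₀ hQ₁) (lawOfSum_mem hP₁ hQ₀)
  rw [eshift] at h0
  rw [binEntropy_eq_negMulLog_add_negMulLog_one_sub,
    show 1 - ((1 - m₁) * n₁ + m₁ * (1 - n₁)) = (1 - m₁) * (1 - n₁) + m₁ * n₁ by ring]
  linarith

/-- A group of order `2 ^ (n + 1)` has a subgroup of order `2 ^ n`; the other coset is `H + t`. -/
lemma exists_index_two {n : ℕ} (hG : Fintype.card G = 2 ^ (n + 1)) :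
    ∃ (H : AddSubgroup G) (t : G), Nat.card H = 2 ^ n ∧ t ∉ H ∧ ∀ g, g ∉ H → g - t ∈ H := by
  have : Fact (Nat.Prime 2) := ⟨Nat.prime_two⟩
  have hcard : Nat.card (Multiplicative G) = 2 ^ (n + 1) := by
    rw [← hG, ← Nat.card_eq_fintype_card]; rfl
  obtain ⟨K, hK⟩ := Sylow.exists_subgroup_card_pow_prime (G := Multiplicative G) 2 (n := n)
    (hcard ▸ pow_dvd_pow 2 n.le_succ)
  have hidx : K.index = 2 := by
    have := K.card_mul_index
    rw [hK, hcard, pow_succ] at this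
    exact Nat.eq_of_mul_eq_mul_left (by positivity) this
  obtain ⟨a, ha⟩ := Subgroup.index_eq_two_iff.1 hidx
  refine ⟨Subgroup.toAddSubgroup' K, -(Multiplicative.toAdd a), hK, ?_, fun g hg => ?_⟩
  · intro hmem
    have h1 : a ∈ K := by simpa using K.inv_mem (show a⁻¹ ∈ K from hmem)
    rcases ha 1 with h | h
    · exact h.2 K.one_mem
    · exact h.2 (by simpa using h1)
  · rcases ha (Multiplicative.ofAdd g) with h | h
    · have := h.1
      rw [sub_neg_eq_add]
      exact this
    · exact absurd h.1 hg

end Sum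

lemma iterGerber_convex_comb_le {n : ℕ} {m₀ m₁ n₀ n₁ u₀ u₁ v₀ v₁ : ℝ}
    (hm₀ : 0 ≤ m₀) (hm₁ : 0 ≤ m₁) (hm : m₀ + m₁ = 1) (hn₀ : 0 ≤ n₀) (hn₁ : 0 ≤ n₁)
    (hn : n₀ + n₁ = 1) (hu₀ : u₀ ∈ Icc 0 (n * log 2)) (hu₁ : u₁ ∈ Icc 0 (n * log 2))
    (hv₀ : v₀ ∈ Icc 0 (n * log 2)) (hv₁ : v₁ ∈ Icc 0 (n * log 2)) :
    iterGerber n (m₀ * u₀ + m₁ * u₁) (n₀ * v₀ + n₁ * v₁)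
      ≤ m₀ * (n₀ * iterGerber n u₀ v₀ + n₁ * iterGerber n u₀ v₁)
        + m₁ * (n₀ * iterGerber n u₁ v₀ + n₁ * iterGerber n u₁ v₁) := by
  have hv : n₀ * v₀ + n₁ * v₁ ∈ Icc 0 (n * log 2) := convex_Icc _ _ hv₀ hv₁ hn₀ hn₁ hn
  have e := (convexOn_iterGerber_left hv).2 hu₀ hu₁ hm₀ hm₁ hm
  have e' : ∀ u ∈ Icc 0 (n * log 2), iterGerber n u (n₀ * v₀ + n₁ * v₁)
      ≤ n₀ * iterGerber n u v₀ + n₁ * iterGerber n u v₁ := fun u hu => by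
    have := (convexOn_iterGerber_left hu).2 hv₀ hv₁ hn₀ hn₁ hn
    simpa only [iterGerber_comm n _ u, smul_eq_mul] using this
  exact e.trans (add_le_add (mul_le_mul_of_nonneg_left (e' _ hu₀) hm₀)
    (mul_le_mul_of_nonneg_left (e' _ hu₁) hm₁))

lemma log_two_pow (n : ℕ) : log ((2 ^ n : ℕ) : ℝ) = n * log 2 := by
  push_cast; exact log_pow 2 n

lemma shannonEntropy_mem {ι : Type*} [Fintype ι] {n : ℕ} (hι : Fintype.card ι = 2 ^ n) {p : ι → ℝ}
    (hp : p ∈ stdSimplex ℝ ι) : shannonEntropy p ∈ Icc 0 (n * log 2) := by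
  refine ⟨shannonEntropy_nonneg hp, ?_⟩
  rw [← log_two_pow, ← hι]
  exact shannonEntropy_le_log_card hp

/-- The entropy inequality for groups of order `2 ^ n`. -/
theorem iterGerber_le_shannonEntropy_lawOfSum (n : ℕ) : ∀ (G : Type u) [AddCommGroup G] [Fintype G],
    Fintype.card G = 2 ^ n → ∀ p ∈ stdSimplex ℝ G, ∀ q ∈ stdSimplex ℝ G,
      iterGerber n (shannonEntropy p) (shannonEntropy q) ≤ shannonEntropy (lawOfSum p q) := by
  induction n with
  | zero =>
    intro G _ _ _ p hp q hq
    exact shannonEntropy_nonneg (lawOfSum_mem hp hq)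
  | succ n ih =>
    intro G _ _ hG p hp q hq
    obtain ⟨H, t, hHcard, ht, hH⟩ := exists_index_two hG
    have : Fintype H := Fintype.ofFinite H
    rw [Nat.card_eq_fintype_card] at hHcard
    obtain ⟨m₀, m₁, hm₀, hm₁, hm, P₀, hP₀, P₁, hP₁, hpm⟩ := exists_cosetMixture_eq ht hH hp
    obtain ⟨n₀, n₁, hn₀, hn₁, hn, Q₀, hQ₀, Q₁, hQ₁, hqm⟩ := exists_cosetMixture_eq ht hH hq
    have hlow := le_shannonEntropy_lawOfSum hpm hqm ht hH hm₀ hm₁ hm hn₀ hn₁ hn hP₀ hP₁ hQ₀ hQ₁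
    have u₀ := shannonEntropy_mem hHcard hP₀
    have u₁ := shannonEntropy_mem hHcard hP₁
    have v₀ := shannonEntropy_mem hHcard hQ₀
    have v₁ := shannonEntropy_mem hHcard hQ₁
    rw [hpm.shannonEntropy_eq ht hH hm hP₀ hP₁, hqm.shannonEntropy_eq ht hH hn hQ₀ hQ₁]
    have hbin : ∀ a ∈ Icc (0 : ℝ) 1, binEntropy a ∈ Icc 0 (log 2) := fun a ha =>
      ⟨binEntropy_nonneg ha.1 ha.2, binEntropy_le_log_two⟩
    refine (iterGerber_add_le (convex_Icc _ _ u₀ u₁ hm₀ hm₁ hm) (convex_Icc _ _ v₀ v₁ hn₀ hn₁ hn)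
      (hbin m₁ ⟨hm₁, by linarith⟩) (hbin n₁ ⟨hn₁, by linarith⟩)).trans (le_trans ?_ hlow)
    refine add_le_add_left
      ((iterGerber_convex_comb_le hm₀ hm₁ hm hn₀ hn₁ hn u₀ u₁ v₀ v₁).trans ?_) _
    have i00 := ih H hHcard P₀ hP₀ Q₀ hQ₀
    have i01 := ih H hHcard P₀ hP₀ Q₁ hQ₁
    have i10 := ih H hHcard P₁ hP₁ Q₀ hQ₀
    have i11 := ih H hHcard P₁ hP₁ Q₁ hQ₁
    gcongr

lemma exists_binEntropy_eq {x : ℝ} (hx : x ∈ Icc 0 (log 2)) :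
    ∃ a ∈ Icc (0 : ℝ) 1, binEntropy a = x := by
  have := bias_mem x
  exact ⟨(1 - bias x) / 2, ⟨by linarith [this.2], by linarith [this.1]⟩, biasEntropy_bias hx⟩

/-- The closed form is attained. For `x` and `y` in the top interval, `X` and `Y` are uniform on
each of the two cosets of a subgroup of index two; an entropy below the top interval is realised
inside that subgroup. -/
theorem exists_shannonEntropy_lawOfSum_eq (n : ℕ) : ∀ (G : Type u) [AddCommGroup G] [Fintype G],
    Fintype.card G = 2 ^ n → ∀ x ∈ Icc 0 (n * log 2), ∀ y ∈ Icc 0 (n * log 2),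
      ∃ p ∈ stdSimplex ℝ G, ∃ q ∈ stdSimplex ℝ G, shannonEntropy p = x ∧ shannonEntropy q = y ∧
        iterGerber n x y = shannonEntropy (lawOfSum p q) := by
  induction n with
  | zero =>
    intro G _ _ hG x hx y hy
    obtain rfl : x = 0 := le_antisymm (by simpa using hx.2) hx.1
    obtain rfl : y = 0 := le_antisymm (by simpa using hy.2) hy.1
    have hU : uniformLaw G ∈ stdSimplex ℝ G := uniformLaw_mem
    have hE : shannonEntropy (uniformLaw G) = 0 := by rw [shannonEntropy_uniformLaw, hG]; simp
    exact ⟨_, hU, _, hU, hE, hE, by rw [lawOfSum_uniformLaw_left hU, hE]; rfl⟩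
  | succ n ih =>
    intro G _ _ hG x hx y hy
    obtain ⟨H, t, hHcard, ht, hH⟩ := exists_index_two hG
    have : Fintype H := Fintype.ofFinite H
    rw [Nat.card_eq_fintype_card] at hHcard
    have hU : uniformLaw H ∈ stdSimplex ℝ H := uniformLaw_mem
    have hE : shannonEntropy (uniformLaw H) = n * log 2 := by
      rw [shannonEntropy_uniformLaw, hHcard, log_two_pow]
    have one_zero : (1 : ℝ) + 0 = 1 := add_zero 1
    have top : ∀ x ∈ Icc (n * log 2) ((n + 1 : ℕ) * log 2), ∃ a ∈ Icc (0 : ℝ) 1,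
        binEntropy a = x - n * log 2 ∧ ∃ p ∈ stdSimplex ℝ G, shannonEntropy p = x ∧
        IsCosetMixture H t p (1 - a) (uniformLaw H) a (uniformLaw H) := by
      intro x hx
      have h2 := hx.2
      push_cast at h2
      obtain ⟨a, ha, hax⟩ := exists_binEntropy_eq (x := x - n * log 2)
        ⟨by linarith [hx.1], by linarith⟩
      obtain ⟨p, hp⟩ := exists_isCosetMixture ht hH (1 - a) a (uniformLaw H) (uniformLaw H)
      refine ⟨a, ha, hax, p, hp.mem_stdSimplex ht hH (sub_nonneg.2 ha.2) ha.1 (by ring) hU hU, ?_,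
        hp⟩
      rw [hp.shannonEntropy_eq ht hH (by ring) hU hU, hE, hax]
      ring
    have mixed : ∀ x ∈ Icc (n * log 2) ((n + 1 : ℕ) * log 2), ∀ y ∈ Icc 0 (n * log 2),
        ∃ p ∈ stdSimplex ℝ G, ∃ q ∈ stdSimplex ℝ G, shannonEntropy p = x ∧ shannonEntropy q = y ∧
        iterGerber (n + 1) x y = shannonEntropy (lawOfSum p q) := by
      intro x hx y hy
      obtain ⟨a, ha, hax, p, hp, hpx, hpm⟩ := top x hx
      obtain ⟨Q, hQ, -, -, hQy, -⟩ := ih H hHcard y hy y hy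
      obtain ⟨q, hqm⟩ := exists_isCosetMixture ht hH 1 0 Q Q
      refine ⟨p, hp, q, hqm.mem_stdSimplex ht hH zero_le_one le_rfl one_zero hQ hQ, hpx, ?_, ?_⟩
      · rw [hqm.shannonEntropy_eq ht hH one_zero hQ hQ, hQy]; simp
      · have hr : IsCosetMixture H t (lawOfSum p q) (1 - a) (uniformLaw H) a (uniformLaw H) :=
          ⟨fun h => by rw [hpm.lawOfSum_coe hqm ht hH, lawOfSum_uniformLaw_left hQ]; ring,
            fun h => by rw [hpm.lawOfSum_add hqm ht hH, lawOfSum_uniformLaw_left hQ]; ring⟩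
        rw [hr.shannonEntropy_eq ht hH (by ring) hU hU, hE, hax,
          iterGerber_succ_of_ge_of_le hx.1 hx.2 hy.2]
        ring
    rcases le_total x (n * log 2) with h1 | h1 <;> rcases le_total y (n * log 2) with h2 | h2
    · obtain ⟨P, hP, Q, hQ, hPx, hQy, hPQ⟩ := ih H hHcard x ⟨hx.1, h1⟩ y ⟨hy.1, h2⟩
      obtain ⟨p, hpm⟩ := exists_isCosetMixture ht hH 1 0 P P
      obtain ⟨q, hqm⟩ := exists_isCosetMixture ht hH 1 0 Q Q
      refine ⟨p, hpm.mem_stdSimplex ht hH zero_le_one le_rfl one_zero hP hP,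
        q, hqm.mem_stdSimplex ht hH zero_le_one le_rfl one_zero hQ hQ, ?_, ?_, ?_⟩
      · rw [hpm.shannonEntropy_eq ht hH one_zero hP hP, hPx]; simp
      · rw [hqm.shannonEntropy_eq ht hH one_zero hQ hQ, hQy]; simp
      · have hr : IsCosetMixture H t (lawOfSum p q) 1 (lawOfSum P Q) 0 (lawOfSum P Q) :=
          ⟨fun h => by rw [hpm.lawOfSum_coe hqm ht hH]; ring,
            fun h => by rw [hpm.lawOfSum_add hqm ht hH]; ring⟩
        rw [hr.shannonEntropy_eq ht hH one_zero (lawOfSum_mem hP hQ) (lawOfSum_mem hP hQ), ← hPQ,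
          iterGerber_succ_of_le h1 h2]
        simp
    · obtain ⟨p, hp, q, hq, hpy, hqx, h⟩ := mixed y ⟨h2, hy.2⟩ x ⟨hx.1, h1⟩
      exact ⟨q, hq, p, hp, hqx, hpy, by rw [iterGerber_comm, h, lawOfSum_comm]⟩
    · exact mixed x ⟨h1, hx.2⟩ y ⟨hy.1, h2⟩
    · obtain ⟨a, ha, hax, p, hp, hpx, hpm⟩ := top x ⟨h1, hx.2⟩
      obtain ⟨b, hb, hby, q, hq, hqy, hqm⟩ := top y ⟨h2, hy.2⟩
      refine ⟨p, hp, q, hq, hpx, hqy, ?_⟩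
      have hr : IsCosetMixture H t (lawOfSum p q) ((1 - a) * (1 - b) + a * b) (uniformLaw H)
          ((1 - a) * b + a * (1 - b)) (uniformLaw H) :=
        ⟨fun h => by
          rw [hpm.lawOfSum_coe hqm ht hH, lawOfSum_uniformLaw_left hU]
          simp only [uniformLaw]; ring,
        fun h => by rw [hpm.lawOfSum_add hqm ht hH, lawOfSum_uniformLaw_left hU]; ring⟩
      rw [hr.shannonEntropy_eq ht hH (by ring) hU hU, hE, ← gerber_binEntropy ha hb, hax, hby,
        iterGerber_succ_of_ge y h1]
      ring

lemma isLeast_sumEntropies {n : ℕ} {G : Type u} [AddCommGroup G] [Fintype G]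
    (hG : Fintype.card G = 2 ^ n) {x y : ℝ} (hx : x ∈ Icc 0 (n * log 2))
    (hy : y ∈ Icc 0 (n * log 2)) : IsLeast (sumEntropies G x y) (iterGerber n x y) := by
  refine ⟨exists_shannonEntropy_lawOfSum_eq n G hG x hx y hy, ?_⟩
  rintro _ ⟨p, hp, q, hq, rfl, rfl, rfl⟩
  exact iterGerber_le_shannonEntropy_lawOfSum n G hG p hp q hq

theorem generalizedMGL_of_card {n : ℕ} {G : Type u} [AddCommGroup G] [Fintype G]
    (hG : Fintype.card G = 2 ^ n) : GeneralizedMGL G := by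
  have key : ∀ x ∈ Icc 0 (n * log 2), ∀ y ∈ Icc 0 (n * log 2),
      minSumEntropy G x y = iterGerber n x y := fun x hx y hy =>
    (isLeast_sumEntropies hG hx hy).csInf_eq
  unfold GeneralizedMGL
  rw [hG, log_two_pow]
  refine ⟨fun x hx y hy => ?_, fun y hy => ?_, fun x hx => ?_⟩
  · rw [key x hx y hy]
    exact isLeast_sumEntropies hG hx hy
  · exact (convexOn_iterGerber_left hy).congr fun x hx => (key x hx y hy).symm
  · refine (convexOn_iterGerber_left hx).congr fun y hy => ?_
    simp only [key x hx y hy, iterGerber_comm n x y]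

end MrsGerber

theorem corollary4p2 (n : ℕ) :
    GeneralizedMGL (ZMod (2 ^ n)) ∧
    ∀ (G : Type*) [AddCommGroup G] [Fintype G], Fintype.card G = 2 ^ n → GeneralizedMGL G :=
  ⟨MrsGerber.generalizedMGL_of_card (ZMod.card _), fun _ _ _ hG =>
    MrsGerber.generalizedMGL_of_card hG⟩
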